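/- Let $c>0$, $d\in\mathbb N$, $\mathcal A=L^2(\mathbb R^d)\cap L^\infty(\mathbb R^d)$ (complex functions modulo a.e. equality) and $\langle f,g\rangle=\int_{\mathbb R^d}\overline{f(x)}\,g(x)\,dx$. Let $U$ be the unital complex $*$-algebra generated by elements $B^+_f,\,B_f,\,N_f$ ($f\in\mathcal A$), with $f\mapsto B^+_f$ and $f\mapsto N_f$ linear and $f\mapsto B_f$ antilinear, involution $(B^+_f)^*=B_f$, $(N_f)^*=N_{\bar f}$, and relations $$[B_f,B^+_g]=2c\langle f,g\rangle 1+4N_{\bar f g},\qquad [N_a,B^+_f]=2B^+_{af},\qquad [B^+_f,B^+_g]=[B_f,B_g]=[N_a,N_{a'}]=0 .$$ There is a unique state $\varphi$ on $U$ (normalized positive linear functional) with $\varphi(xB_g)=\varphi(xN_f)=0$ for all $x\in U$, $f,g\in\mathcal A$. Its GNS space $\Gamma_2(\mathcal A)$, with cyclic vector $\Phi$, is the quadratic Fock space. (1) For all $n\ge 0$ and all $f,g\in\mathcal A$, $$\langle B^{+n}_f\Phi,\,B^{+n}_g\Phi\rangle=\sum_{i_1+2i_2+\dots+n i_n=n}\frac{(n!)^2\,2^{2n}\,(c/2)^{\,i_1+\dots+i_n}}{i_1!\cdots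 i_n!\;1^{i_1}2^{i_2}\cdots n^{i_n}}\;\langle f,g\rangle^{i_1}\langle f^2,g^2\rangle^{i_2}\cdots\langle f^n,g^n\rangle^{i_n},$$ the sum being over all $(i_1,\dots,i_n)\in\mathbb N^n$ with $i_1+2i_2+\dots+ni_n=n$. (2) For every $n$ let $\mathcal A^{\otimes n}_{symm}$ be the space of symmetric tensors in the $n$-fold algebraic tensor power of $\mathcal A$. There is exactly one family of (positive definite) scalar products $\langle\cdot,\cdot\rangle_n$ on $\mathcal A^{\otimes n}_{symm}$, $n\ge 0$, such that $\langle f^{\otimes n},g^{\otimes n}\rangle_n$ equals the right-hand side of (1) for all $n$ and all $f,g\in\mathcal A$. Let the interacting Fock space be the Hilbert space direct sum over $n\ge 0$ of the completions of $(\mathcal A^{\otimes n}_{symm},\langle\cdot,\cdot\rangle_n)$. Then there is exactly one unitary isomorphism from the interacting Fock space onto $\Gamma_2(\mathcal A)$ that maps $f^{\otimes n}$ (in the $n$-th summand) to $B^{+n}_f\Phi$ for all $n\ge 0$ and $f\in\mathcal A$. -/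

import Mathlib

open MeasureTheory
open scoped ENNReal ComplexConjugate TensorProduct

noncomputable section

/-! ### The test function algebra `L²(ℝᵈ) ∩ L^∞(ℝᵈ)` -/

/-- `L²(ℝᵈ) ∩ L^∞(ℝᵈ)`: complex functions modulo almost everywhere equality. -/
def testFn (d : ℕ) : Submodule ℂ (EuclideanSpace ℝ (Fin d) →ₘ[volume] ℂ) where
  carrier := {f | MemLp f 2 volume ∧ MemLp f ∞ volume}
  add_mem' := by
    rintro f g ⟨hf, hf'⟩ ⟨hg, hg'⟩
    exact ⟨(hf.add hg).ae_eq (AEEqFun.coeFn_add f g).symm,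
      (hf'.add hg').ae_eq (AEEqFun.coeFn_add f g).symm⟩
  zero_mem' :=
    ⟨(MemLp.zero (p := 2)).ae_eq AEEqFun.coeFn_zero.symm,
      (MemLp.zero (p := ∞)).ae_eq AEEqFun.coeFn_zero.symm⟩
  smul_mem' := by
    rintro a f ⟨hf, hf'⟩
    exact ⟨(hf.const_smul a).ae_eq (AEEqFun.coeFn_smul a f).symm,
      (hf'.const_smul a).ae_eq (AEEqFun.coeFn_smul a f).symm⟩

/-- The type of test functions. -/
def TestFn (d : ℕ) : Type := testFn d

namespace TestFn

variable {d : ℕ}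

instance : AddCommGroup (TestFn d) := inferInstanceAs (AddCommGroup (testFn d))
instance : Module ℂ (TestFn d) := inferInstanceAs (Module ℂ (testFn d))

/-- The underlying function class. -/
def toAE (f : TestFn d) : EuclideanSpace ℝ (Fin d) →ₘ[volume] ℂ := Subtype.val f

lemma memLp_two (f : TestFn d) : MemLp f.toAE 2 volume := (Subtype.property f).1

lemma memLp_top (f : TestFn d) : MemLp f.toAE ∞ volume := (Subtype.property f).2

/-- Constructor. -/
def mk (f : EuclideanSpace ℝ (Fin d) →ₘ[volume] ℂ) (h : MemLp f 2 volume)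
    (h' : MemLp f ∞ volume) : TestFn d :=
  (⟨f, h, h'⟩ : testFn d)

lemma ext_ae {f g : TestFn d} (h : f.toAE =ᵐ[volume] g.toAE) : f = g :=
  Subtype.ext (AEEqFun.ext h)

/-- Pointwise product of test functions. -/
instance : Mul (TestFn d) where
  mul f g := mk (f.toAE * g.toAE)
    ((g.memLp_two.mul f.memLp_top).ae_eq (AEEqFun.coeFn_mul _ _).symm)
    ((g.memLp_top.mul f.memLp_top).ae_eq (AEEqFun.coeFn_mul _ _).symm)

/-- Pointwise complex conjugate of a test function. -/
instance : Star (TestFn d) where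
  star f := mk (star f.toAE)
    (f.memLp_two.star.ae_eq (AEEqFun.coeFn_star _).symm)
    (f.memLp_top.star.ae_eq (AEEqFun.coeFn_star _).symm)

lemma coe_add (f g : TestFn d) : (f + g).toAE =ᵐ[volume] fun x => f.toAE x + g.toAE x :=
  AEEqFun.coeFn_add f.toAE g.toAE

lemma coe_smul (a : ℂ) (f : TestFn d) : (a • f).toAE =ᵐ[volume] fun x => a * f.toAE x :=
  AEEqFun.coeFn_smul a f.toAE

lemma coe_mul (f g : TestFn d) : (f * g).toAE =ᵐ[volume] fun x => f.toAE x * g.toAE x :=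
  AEEqFun.coeFn_mul f.toAE g.toAE

lemma coe_star (f : TestFn d) : (star f).toAE =ᵐ[volume] fun x => conj (f.toAE x) :=
  AEEqFun.coeFn_star f.toAE

/-- `⟨fᵏ, gᵏ⟩ = ∫ conj (f(x)ᵏ) g(x)ᵏ dx`, an absolutely convergent integral for `k ≥ 1`. -/
def innerPow (k : ℕ) (f g : TestFn d) : ℂ :=
  ∫ x : EuclideanSpace ℝ (Fin d), conj (f.toAE x ^ k) * g.toAE x ^ k

/-- The scalar product `⟨f, g⟩` of `L²(ℝᵈ)`, antilinear in the first variable. -/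
def inner (f g : TestFn d) : ℂ := innerPow 1 f g

lemma star_star (f : TestFn d) : star (star f) = f := by
  refine ext_ae ?_
  filter_upwards [coe_star f, coe_star (star f)] with x h1 h2
  simp [h1, h2]

lemma star_add (f g : TestFn d) : star (f + g) = star f + star g := by
  refine ext_ae ?_
  filter_upwards [coe_star (f + g), coe_add f g, coe_add (star f) (star g), coe_star f,
    coe_star g] with x h1 h2 h3 h4 h5
  simp [h1, h2, h3, h4, h5]

lemma star_smul (a : ℂ) (f : TestFn d) : star (a • f) = conj a • star f := by
  refine ext_ae ?_
  filter_upwards [coe_star (a • f), coe_smul a f, coe_smul (conj a) (star f),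
    coe_star f] with x h1 h2 h3 h4
  simp [h1, h2, h3, h4]

lemma star_star_mul (f g : TestFn d) : star (star f * g) = star g * f := by
  refine ext_ae ?_
  filter_upwards [coe_star (star f * g), coe_mul (star f) g, coe_mul (star g) f,
    coe_star f, coe_star g] with x h1 h2 h3 h4 h5
  simp [h1, h2, h3, h4, h5, mul_comm]

lemma conj_inner (f g : TestFn d) : conj (inner f g) = inner g f := by
  unfold inner innerPow
  rw [← integral_conj]
  refine integral_congr_ae (Filter.Eventually.of_forall fun x => ?_)
  simp [mul_comm]

end TestFn

/-! ### The algebra of the renormalized square of white noise -/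

/-- The generators `B⁺_f`, `B_f`, `N_f`. -/
inductive RSWNGen (d : ℕ) : Type
  | bplus (f : TestFn d)
  | b (f : TestFn d)
  | num (f : TestFn d)

/-- The involution on generators: `(B⁺_f)* = B_f`, `(B_f)* = B⁺_f`, `(N_f)* = N_{conj f}`. -/
def RSWNGen.adj {d : ℕ} : RSWNGen d → RSWNGen d
  | .bplus f => .b f
  | .b f => .bplus f
  | .num f => .num (star f)

open RSWNGen in
/-- The defining relations. `B⁺` and `N` are linear and `B` is antilinear in the test function;
`[B_f, B⁺_g] = 2c⟨f, g⟩ + 4 N_{conj(f) g}`, `[N_a, B⁺_f] = 2 B⁺_{af}` and its adjoint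
`[B_f, N_{conj a}] = 2 B_{af}`; the remaining commutators vanish. -/
inductive RSWNRel (d : ℕ) (c : ℝ) :
    FreeAlgebra ℂ (RSWNGen d) → FreeAlgebra ℂ (RSWNGen d) → Prop
  | bplus_add (f g : TestFn d) : RSWNRel d c (FreeAlgebra.ι ℂ (bplus (f + g)))
      (FreeAlgebra.ι ℂ (bplus f) + FreeAlgebra.ι ℂ (bplus g))
  | bplus_smul (a : ℂ) (f : TestFn d) : RSWNRel d c (FreeAlgebra.ι ℂ (bplus (a • f)))
      (a • FreeAlgebra.ι ℂ (bplus f))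
  | b_add (f g : TestFn d) : RSWNRel d c (FreeAlgebra.ι ℂ (b (f + g)))
      (FreeAlgebra.ι ℂ (b f) + FreeAlgebra.ι ℂ (b g))
  | b_smul (a : ℂ) (f : TestFn d) : RSWNRel d c (FreeAlgebra.ι ℂ (b (a • f)))
      (conj a • FreeAlgebra.ι ℂ (b f))
  | num_add (f g : TestFn d) : RSWNRel d c (FreeAlgebra.ι ℂ (num (f + g)))
      (FreeAlgebra.ι ℂ (num f) + FreeAlgebra.ι ℂ (num g))
  | num_smul (a : ℂ) (f : TestFn d) : RSWNRel d c (FreeAlgebra.ι ℂ (num (a • f)))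
      (a • FreeAlgebra.ι ℂ (num f))
  | comm_b_bplus (f g : TestFn d) : RSWNRel d c
      (FreeAlgebra.ι ℂ (b f) * FreeAlgebra.ι ℂ (bplus g)
        - FreeAlgebra.ι ℂ (bplus g) * FreeAlgebra.ι ℂ (b f))
      ((2 * (c : ℂ) * TestFn.inner f g) • (1 : FreeAlgebra ℂ (RSWNGen d))
        + (4 : ℂ) • FreeAlgebra.ι ℂ (num (star f * g)))
  | comm_num_bplus (a f : TestFn d) : RSWNRel d c
      (FreeAlgebra.ι ℂ (num a) * FreeAlgebra.ι ℂ (bplus f)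
        - FreeAlgebra.ι ℂ (bplus f) * FreeAlgebra.ι ℂ (num a))
      ((2 : ℂ) • FreeAlgebra.ι ℂ (bplus (a * f)))
  | comm_b_num (a f : TestFn d) : RSWNRel d c
      (FreeAlgebra.ι ℂ (b f) * FreeAlgebra.ι ℂ (num (star a))
        - FreeAlgebra.ι ℂ (num (star a)) * FreeAlgebra.ι ℂ (b f))
      ((2 : ℂ) • FreeAlgebra.ι ℂ (b (a * f)))
  | comm_bplus_bplus (f g : TestFn d) : RSWNRel d c
      (FreeAlgebra.ι ℂ (bplus f) * FreeAlgebra.ι ℂ (bplus g)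
        - FreeAlgebra.ι ℂ (bplus g) * FreeAlgebra.ι ℂ (bplus f)) 0
  | comm_b_b (f g : TestFn d) : RSWNRel d c
      (FreeAlgebra.ι ℂ (b f) * FreeAlgebra.ι ℂ (b g)
        - FreeAlgebra.ι ℂ (b g) * FreeAlgebra.ι ℂ (b f)) 0
  | comm_num_num (a a' : TestFn d) : RSWNRel d c
      (FreeAlgebra.ι ℂ (num a) * FreeAlgebra.ι ℂ (num a')
        - FreeAlgebra.ι ℂ (num a') * FreeAlgebra.ι ℂ (num a)) 0

/-- `U(RSWN)`: the universal enveloping algebra of the RSWN Lie algebra, the central element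
being identified with the unit. It is the unital complex algebra presented by the generators
`B⁺_f`, `B_f`, `N_f` and the relations above. -/
def RSWN (d : ℕ) (c : ℝ) : Type := RingQuot (RSWNRel d c)

namespace RSWN

variable {d : ℕ} {c : ℝ}

instance : Ring (RSWN d c) := inferInstanceAs (Ring (RingQuot (RSWNRel d c)))
instance : Algebra ℂ (RSWN d c) := inferInstanceAs (Algebra ℂ (RingQuot (RSWNRel d c)))

/-- The quotient map from the free algebra. -/
def mk (d : ℕ) (c : ℝ) : FreeAlgebra ℂ (RSWNGen d) →ₐ[ℂ] RSWN d c :=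
  RingQuot.mkAlgHom ℂ (RSWNRel d c)

/-- The class of a generator. -/
def gen (x : RSWNGen d) : RSWN d c := mk d c (FreeAlgebra.ι ℂ x)

/-- `B⁺_f`. -/
def Bplus (f : TestFn d) : RSWN d c := gen (.bplus f)

/-- `B_f`. -/
def B (f : TestFn d) : RSWN d c := gen (.b f)

/-- `N_f`. -/
def N (f : TestFn d) : RSWN d c := gen (.num f)

lemma mk_rel {x y : FreeAlgebra ℂ (RSWNGen d)} (h : RSWNRel d c x y) : mk d c x = mk d c y :=
  RingQuot.mkAlgHom_rel ℂ h

end RSWN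

/-- The opposite algebra with conjugated scalar action; used to construct the involution. -/
def ConjOp (R : Type) : Type := Rᵐᵒᵖ

namespace ConjOp

variable {R : Type} [Ring R]

instance : Ring (ConjOp R) := inferInstanceAs (Ring Rᵐᵒᵖ)

instance [Algebra ℂ R] : Algebra ℂ (ConjOp R) :=
  RingHom.toAlgebra' ((algebraMap ℂ Rᵐᵒᵖ).comp (starRingEnd ℂ))
    fun a x => Algebra.commutes (A := Rᵐᵒᵖ) (conj a) x

/-- The element of the conjugate opposite algebra given by an element of the algebra. -/
def op (x : R) : ConjOp R := MulOpposite.op x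

/-- Inverse of `ConjOp.op`. -/
def unop (x : ConjOp R) : R := MulOpposite.unop x

lemma op_add (x y : R) : op (x + y) = op x + op y := rfl
lemma op_sub (x y : R) : op (x - y) = op x - op y := rfl
lemma op_mul (x y : R) : op x * op y = op (y * x) := rfl
lemma op_zero : op (0 : R) = 0 := rfl
lemma op_one : op (1 : R) = 1 := rfl
lemma unop_op {S : Type} (x : S) : unop (op x) = x := rfl
lemma unop_add (x y : ConjOp R) : unop (x + y) = unop x + unop y := rfl
lemma unop_mul (x y : ConjOp R) : unop (x * y) = unop y * unop x := rfl
lemma smul_op [Algebra ℂ R] (a : ℂ) (x : R) : a • op x = op (conj a • x) := by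
  rw [Algebra.smul_def, Algebra.smul_def]
  exact congrArg MulOpposite.op (Algebra.commutes (conj a) x).symm

end ConjOp

namespace RSWN

variable {d : ℕ} {c : ℝ}

/-- The involution as an algebra homomorphism on the free algebra. -/
def preStar (d : ℕ) (c : ℝ) : FreeAlgebra ℂ (RSWNGen d) →ₐ[ℂ] ConjOp (RSWN d c) :=
  FreeAlgebra.lift ℂ fun x => ConjOp.op (gen x.adj)

lemma preStar_ι (x : RSWNGen d) :
    preStar d c (FreeAlgebra.ι ℂ x) = ConjOp.op (mk d c (FreeAlgebra.ι ℂ x.adj)) := by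
  simp [preStar, gen]

lemma preStar_rel {x y : FreeAlgebra ℂ (RSWNGen d)} (h : RSWNRel d c x y) :
    preStar d c x = preStar d c y := by
  cases h with
  | bplus_add f g =>
    simpa [preStar_ι, RSWNGen.adj, ConjOp.op_add] using
      congrArg ConjOp.op (mk_rel (RSWNRel.b_add (c := c) f g))
  | bplus_smul a f =>
    simpa [preStar_ι, RSWNGen.adj, ConjOp.smul_op] using
      congrArg ConjOp.op (mk_rel (RSWNRel.b_smul (c := c) a f))
  | b_add f g =>
    simpa [preStar_ι, RSWNGen.adj, ConjOp.op_add] using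
      congrArg ConjOp.op (mk_rel (RSWNRel.bplus_add (c := c) f g))
  | b_smul a f =>
    simpa [preStar_ι, RSWNGen.adj, ConjOp.smul_op] using
      congrArg ConjOp.op (mk_rel (RSWNRel.bplus_smul (c := c) a f))
  | num_add f g =>
    simpa [preStar_ι, RSWNGen.adj, ConjOp.op_add, TestFn.star_add] using
      congrArg ConjOp.op (mk_rel (RSWNRel.num_add (c := c) (star f) (star g)))
  | num_smul a f =>
    simpa [preStar_ι, RSWNGen.adj, ConjOp.smul_op, TestFn.star_smul] using
      congrArg ConjOp.op (mk_rel (RSWNRel.num_smul (c := c) (conj a) (star f)))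
  | comm_b_bplus f g =>
    have h := congrArg ConjOp.op (mk_rel (RSWNRel.comm_b_bplus (c := c) g f))
    have e1 : (4 : ℂ) = conj (4 : ℂ) := (Complex.conj_ofNat 4).symm
    have e2 : 2 * (c : ℂ) * TestFn.inner g f = conj (2 * (c : ℂ) * TestFn.inner f g) := by
      rw [map_mul, map_mul, TestFn.conj_inner, Complex.conj_ofReal, Complex.conj_ofNat]
    rw [e1, e2, map_add, map_smul, map_smul, ConjOp.op_add, ← ConjOp.smul_op,
      ← ConjOp.smul_op] at h
    simpa [preStar_ι, RSWNGen.adj, ConjOp.op_mul, ConjOp.op_add, ConjOp.op_sub,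
      ConjOp.op_one, TestFn.star_star_mul] using h
  | comm_num_bplus a f =>
    have h := congrArg ConjOp.op (mk_rel (RSWNRel.comm_b_num (c := c) a f))
    have e1 : (2 : ℂ) = conj (2 : ℂ) := (Complex.conj_ofNat 2).symm
    rw [e1] at h
    simpa [preStar_ι, RSWNGen.adj, ConjOp.op_mul, ConjOp.op_sub, ← ConjOp.smul_op] using h
  | comm_b_num a f =>
    have h := congrArg ConjOp.op (mk_rel (RSWNRel.comm_num_bplus (c := c) a f))
    have e1 : (2 : ℂ) = conj (2 : ℂ) := (Complex.conj_ofNat 2).symm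
    rw [e1] at h
    simpa [preStar_ι, RSWNGen.adj, ConjOp.op_mul, ConjOp.op_sub, ← ConjOp.smul_op,
      TestFn.star_star] using h
  | comm_bplus_bplus f g =>
    simpa [preStar_ι, RSWNGen.adj, ConjOp.op_mul, ConjOp.op_sub, ConjOp.op_zero] using
      congrArg ConjOp.op (mk_rel (RSWNRel.comm_b_b (c := c) g f))
  | comm_b_b f g =>
    simpa [preStar_ι, RSWNGen.adj, ConjOp.op_mul, ConjOp.op_sub, ConjOp.op_zero] using
      congrArg ConjOp.op (mk_rel (RSWNRel.comm_bplus_bplus (c := c) g f))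
  | comm_num_num a a' =>
    simpa [preStar_ι, RSWNGen.adj, ConjOp.op_mul, ConjOp.op_sub, ConjOp.op_zero] using
      congrArg ConjOp.op (mk_rel (RSWNRel.comm_num_num (c := c) (star a') (star a)))

/-- The involution as an algebra homomorphism to the conjugate opposite algebra. -/
def starHom (d : ℕ) (c : ℝ) : RSWN d c →ₐ[ℂ] ConjOp (RSWN d c) :=
  RingQuot.liftAlgHom ℂ ⟨preStar d c, fun _ _ h => preStar_rel h⟩

lemma starHom_gen (x : RSWNGen d) : starHom d c (gen x) = ConjOp.op (gen x.adj) := by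
  have : starHom d c (mk d c (FreeAlgebra.ι ℂ x)) = preStar d c (FreeAlgebra.ι ℂ x) :=
    RingQuot.liftAlgHom_mkAlgHom_apply (S := ℂ) _ _ _
  exact this.trans (preStar_ι x)

lemma adj_adj (x : RSWNGen d) : x.adj.adj = x := by
  cases x <;> simp [RSWNGen.adj, TestFn.star_star]

lemma unop_starHom_unop_starHom (x : RSWN d c) :
    ConjOp.unop (starHom d c (ConjOp.unop (starHom d c x))) = x := by
  let F : RSWN d c →ₐ[ℂ] RSWN d c :=
    { toFun := fun x => ConjOp.unop (starHom d c (ConjOp.unop (starHom d c x)))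
      map_one' := by rw [map_one, ← ConjOp.op_one, ConjOp.unop_op, map_one]; rfl
      map_mul' := fun x y => by simp [ConjOp.unop_mul]
      map_zero' := by rw [map_zero, ← ConjOp.op_zero, ConjOp.unop_op, map_zero]; rfl
      map_add' := fun x y => by simp [ConjOp.unop_add]
      commutes' := fun a => by
        have key : ∀ b : ℂ, ConjOp.unop (starHom d c (algebraMap ℂ _ b))
            = algebraMap ℂ (RSWN d c) (conj b) := fun b => by
          rw [AlgHom.commutes]; rfl
        rw [key, key, Complex.conj_conj] }
  have hF : F = AlgHom.id ℂ _ := by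
    refine RingQuot.ringQuot_ext' (S := ℂ) (s := RSWNRel d c) _ _ ?_
    refine FreeAlgebra.hom_ext (funext fun x => ?_)
    change ConjOp.unop (starHom d c (ConjOp.unop (starHom d c (gen x)))) = gen x
    rw [starHom_gen, ConjOp.unop_op, starHom_gen, ConjOp.unop_op, adj_adj]
  exact DFunLike.congr_fun hF x

/-- The antilinear involution of `U(RSWN)`. -/
instance : StarRing (RSWN d c) where
  star x := ConjOp.unop (starHom d c x)
  star_involutive := unop_starHom_unop_starHom
  star_mul x y := by change ConjOp.unop (starHom d c (x * y)) = _; rw [map_mul]; rfl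
  star_add x y := by change ConjOp.unop (starHom d c (x + y)) = _; rw [map_add]; rfl

instance : StarModule ℂ (RSWN d c) where
  star_smul a x := by
    change ConjOp.unop (starHom d c (a • x)) = _
    rw [map_smul]
    exact congrArg ConjOp.unop (ConjOp.smul_op a (ConjOp.unop (starHom d c x)))

lemma star_Bplus (f : TestFn d) : star (Bplus f : RSWN d c) = B f :=
  congrArg ConjOp.unop (starHom_gen (.bplus f))

lemma star_B (f : TestFn d) : star (B f : RSWN d c) = Bplus f :=
  congrArg ConjOp.unop (starHom_gen (.b f))

lemma star_N (f : TestFn d) : star (N f : RSWN d c) = N (star f) :=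
  congrArg ConjOp.unop (starHom_gen (.num f))

end RSWN

/-! ### States and their GNS spaces -/

/-- A state on a unital complex `*`-algebra: a normalized positive linear functional. -/
@[ext]
structure AlgState (U : Type) [Ring U] [StarRing U] [Algebra ℂ U] where
  toFun : U →ₗ[ℂ] ℂ
  map_one : toFun 1 = 1
  nonneg_re : ∀ x, 0 ≤ (toFun (star x * x)).re
  im_eq_zero : ∀ x, (toFun (star x * x)).im = 0

namespace AlgState

variable {U : Type} [Ring U] [StarRing U] [Algebra ℂ U] [StarModule ℂ U]

lemma conj_apply (φ : AlgState U) (x : U) : conj (φ.toFun x) = φ.toFun (star x) := by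
  have h1 := φ.im_eq_zero (1 + x)
  have h2 := φ.im_eq_zero (1 + Complex.I • x)
  have h0 := φ.im_eq_zero x
  simp only [star_add, star_one, star_smul, mul_add, add_mul, one_mul, mul_one, map_add,
    smul_mul_assoc, mul_smul_comm, map_smul, smul_eq_mul, φ.map_one, Complex.add_im,
    Complex.one_im, Complex.mul_im, Complex.mul_re, Complex.I_re, Complex.I_im, Complex.star_def,
    Complex.conj_I, Complex.neg_re, Complex.neg_im, h0] at h1 h2
  apply Complex.ext
  · rw [Complex.conj_re]; linarith
  · rw [Complex.conj_im]; linarith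

/-- The algebra `U`, regarded as a pre-Hilbert space with `⟨x, y⟩ = φ(x* y)`. -/
def PreGNS (_φ : AlgState U) : Type := U

instance (φ : AlgState U) : AddCommGroup φ.PreGNS := inferInstanceAs (AddCommGroup U)
instance (φ : AlgState U) : Module ℂ φ.PreGNS := inferInstanceAs (Module ℂ U)

/-- The positive semidefinite scalar product `⟨x, y⟩ = φ(x* y)`. -/
@[reducible]
def gnsCore (φ : AlgState U) : PreInnerProductSpace.Core ℂ φ.PreGNS where
  inner x y := φ.toFun (star (show U from x) * (show U from y))
  conj_inner_symm x y := by
    have := φ.conj_apply (star (show U from y) * (show U from x))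
    rw [star_mul, star_star] at this
    exact this
  re_inner_nonneg x := φ.nonneg_re x
  add_left x y z := by
    change φ.toFun (star ((show U from x) + (show U from y)) * (show U from z)) = _
    rw [star_add, add_mul, map_add]
  smul_left x y a := by
    change φ.toFun (star (a • (show U from x)) * (show U from y)) = _
    rw [star_smul, smul_mul_assoc, map_smul]
    rfl

instance (φ : AlgState U) : SeminormedAddCommGroup φ.PreGNS :=
  @InnerProductSpace.Core.toSeminormedAddCommGroup ℂ φ.PreGNS _ _ _ φ.gnsCore

instance (φ : AlgState U) : InnerProductSpace ℂ φ.PreGNS := InnerProductSpace.ofCore φ.gnsCore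

/-- The GNS Hilbert space of a state: the Hausdorff completion of `U` for `⟨x, y⟩ = φ(x* y)`. -/
abbrev GNS (φ : AlgState U) : Type := UniformSpace.Completion φ.PreGNS

/-- The vector `xΦ` of the GNS space, where `Φ` is the cyclic vector, the class of `1`. -/
def vec (φ : AlgState U) (x : U) : φ.GNS := ((show φ.PreGNS from x : φ.PreGNS) : φ.GNS)

lemma inner_vec (φ : AlgState U) (x y : U) :
    Inner.inner ℂ (φ.vec x) (φ.vec y) = φ.toFun (star x * y) :=
  UniformSpace.Completion.inner_coe _ _

end AlgState

/-- The quadratic Fock state on `U(RSWN)`: the state with `φ(x B_g) = φ(x N_f) = 0`. -/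
def AlgState.IsQuadraticFock {d : ℕ} {c : ℝ} (φ : AlgState (RSWN d c)) : Prop :=
  (∀ (x : RSWN d c) (g : TestFn d), φ.toFun (x * RSWN.B g) = 0) ∧
    ∀ (x : RSWN d c) (f : TestFn d), φ.toFun (x * RSWN.N f) = 0

/-- The vector `B⁺ⁿ_f Φ` of the GNS space of a state on `U(RSWN)`. -/
def AlgState.particleVec {d : ℕ} {c : ℝ} (φ : AlgState (RSWN d c)) (n : ℕ) (f : TestFn d) :
    φ.GNS :=
  φ.vec (RSWN.Bplus f ^ n)

/-! ### The scalar product formula and the interacting Fock space -/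

/-- The sum over all partitions `n = i₁ + 2i₂ + ⋯ + n iₙ` of
`(n!)² 2²ⁿ (c/2)^(i₁ + ⋯ + iₙ) / (i₁! ⋯ iₙ! 1^{i₁} 2^{i₂} ⋯ n^{iₙ})
  ⟨f, g⟩^{i₁} ⟨f², g²⟩^{i₂} ⋯ ⟨fⁿ, gⁿ⟩^{iₙ}`;
here `iⱼ` is the multiplicity of the part `j`, and `i₁ + ⋯ + iₙ` the number of parts. -/
def partitionSum {d : ℕ} (c : ℝ) (n : ℕ) (f g : TestFn d) : ℂ :=
  ∑ p : Nat.Partition n,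
    ((n.factorial : ℂ) ^ 2 * 2 ^ (2 * n) * ((c : ℂ) / 2) ^ (∑ j ∈ Finset.Icc 1 n, p.parts.count j)
      / ∏ j ∈ Finset.Icc 1 n, (((p.parts.count j).factorial : ℂ) * (j : ℂ) ^ p.parts.count j))
      * ∏ j ∈ Finset.Icc 1 n, TestFn.innerPow j f g ^ p.parts.count j

/-- The symmetric tensors in the `n`-fold algebraic tensor power of the test function space. -/
def symTensor (d n : ℕ) : Submodule ℂ (⨂[ℂ] _ : Fin n, TestFn d) where
  carrier := {x | ∀ σ : Equiv.Perm (Fin n),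
    PiTensorProduct.reindex ℂ (fun _ : Fin n => TestFn d) σ x = x}
  add_mem' hx hy σ := by rw [map_add, hx σ, hy σ]
  zero_mem' σ := map_zero _
  smul_mem' a x hx σ := by rw [map_smul, hx σ]

/-- The symmetric tensor `f^{⊗ n}`. -/
def tensorPow {d : ℕ} (n : ℕ) (f : TestFn d) : symTensor d n :=
  ⟨PiTensorProduct.tprod ℂ fun _ => f, fun σ => PiTensorProduct.reindex_tprod σ _⟩

/-- A choice, for every `n`, of a (positive definite) scalar product on the symmetric
`n`-tensors. -/
abbrev ScalarProducts (d : ℕ) : Type := ∀ n, InnerProductSpace.Core ℂ (symTensor d n)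

/-- The symmetric `n`-tensors with the `n`-th scalar product of the family. -/
def PreParticle {d : ℕ} (_s : ScalarProducts d) (n : ℕ) : Type := symTensor d n

section

variable {d : ℕ} (s : ScalarProducts d) (n : ℕ)

instance : AddCommGroup (PreParticle s n) := inferInstanceAs (AddCommGroup (symTensor d n))
instance : Module ℂ (PreParticle s n) := inferInstanceAs (Module ℂ (symTensor d n))

instance : NormedAddCommGroup (PreParticle s n) :=
  @InnerProductSpace.Core.toNormedAddCommGroup ℂ (PreParticle s n) _ _ _ (s n)

instance : InnerProductSpace ℂ (PreParticle s n) := InnerProductSpace.ofCore (s n).toCore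

/-- The `n`-particle Hilbert space: completion for the `n`-th scalar product. -/
abbrev Particle : Type := UniformSpace.Completion (PreParticle s n)

/-- The interacting Fock space: Hilbert space direct sum of the `n`-particle spaces. -/
abbrev IFS : Type := lp (fun n => Particle s n) 2

/-- A symmetric `n`-tensor as a vector of the interacting Fock space. -/
def IFS.ofTensor (x : symTensor d n) : IFS s :=
  lp.single 2 n ((show PreParticle s n from x : PreParticle s n) : Particle s n)

end

end

/-!
The scalar product formula and the existence of the quadratic Fock state rest on the same two
facts: `U(RSWN)` has a normal ordering, and the sum over partitions is a positive definite kernel.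

*Normal ordering.* Let `L` be the left ideal generated by the `B_g` and `N_f`. Moving these
generators to the right shows that `U(RSWN)` is the sum of `L` and of the span of the words
`B⁺_{f₁} ⋯ B⁺_{fₙ}` (`RSWN.iSup_particleSpace_sup`); as the `B⁺_f` commute, polarization
(`span_tensorPow`) reduces words to powers. A functional that is normalized and vanishes on `L` and
on the right ideal generated by the `B⁺_f` and `N_f` is therefore unique (`IsVacuum.unique`), and
hence hermitian. Every quadratic Fock state is such a functional.

*Existence of the functional.* Functions `F` of a test function `h` carry a representation of
`U(RSWN)` by first order differential operators: `B_f` is the derivative along `f`, `N_a` the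
derivative along `2 ā h`, and `B⁺_g` the derivative along `4 ḡ h²` plus the multiplication by
`2c ⟨h, g⟩`. It preserves the polynomials in the power sums `∫ conj(h)^{k+1} u`, on which it is
given by derivations, so that the relations need to be checked on the power sums only. The value at
`h = 0` of `x · 1` is the required functional (`exists_isVacuum`).

*The formula.* Moving `B_w` through `B⁺ᵐ_g`, and the adjoint of this identity, give a recursion for
`φ(B_f^m B_w B⁺_g^{m+1})` in `m`. It is solved by a convolution, which for `w = f` says that
`κₙ = φ(Bⁿ_f B⁺ⁿ_g) / (n!² 4ⁿ)` satisfies `n κₙ = (c/2) ∑ₖ ⟨fᵏ, gᵏ⟩ κₙ₋ₖ`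
(`IsVacuum.moment_succ`). The sum over partitions satisfies the same recursion, Newton's identity
between power sums and complete homogeneous symmetric functions (`cycleSum_succ`).

*Positivity.* For each partition of `n`, multiplying the entries of an `n`-tensor in blocks whose
sizes are the parts maps symmetric `n`-tensors to a tensor power of `L²`, and pulls the scalar
product back to a positive semidefinite form with value `∏ⱼ ⟨fʲ, gʲ⟩^{iⱼ}` on powers. The sum over
partitions is the sum of these forms with positive coefficients, and is definite since the partition
`1 + ⋯ + 1` contributes the scalar product of the tensor power itself (`exists_scalarProduct`).
Modulo `L`, each `x` is a sum of images of symmetric tensors `yₙ`, with `φ(x* x) = ∑ₙ ⟨yₙ, yₙ⟩ₙ`.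

The same computation identifies the completions of the spaces of symmetric tensors with mutually
orthogonal subspaces of the GNS space that together span it (`isHilbertSum_particleIsometry`).
-/

noncomputable section

/-! ### The test functions as a commutative `*`-algebra with a scalar product -/

namespace TestFn

variable {d : ℕ}

instance : NonUnitalCommRing (TestFn d) where
  left_distrib f g h := by
    refine ext_ae ?_
    filter_upwards [coe_mul f (g + h), coe_add g h, coe_add (f * g) (f * h), coe_mul f g,
      coe_mul f h] with x h1 h2 h3 h4 h5
    rw [h1, h2, h3, h4, h5, mul_add]
  right_distrib f g h := by
    refine ext_ae ?_
    filter_upwards [coe_mul (f + g) h, coe_add f g, coe_add (f * h) (g * h), coe_mul f h,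
      coe_mul g h] with x h1 h2 h3 h4 h5
    rw [h1, h2, h3, h4, h5, add_mul]
  zero_mul f := by
    refine ext_ae ?_
    filter_upwards [coe_mul 0 f, coe_smul 0 (0 : TestFn d)] with x h1 h2
    rw [zero_smul] at h2
    rw [h1, h2]
    ring
  mul_zero f := by
    refine ext_ae ?_
    filter_upwards [coe_mul f 0, coe_smul 0 (0 : TestFn d)] with x h1 h2
    rw [zero_smul] at h2
    rw [h1, h2]
    ring
  mul_assoc f g h := by
    refine ext_ae ?_
    filter_upwards [coe_mul (f * g) h, coe_mul f g, coe_mul f (g * h), coe_mul g h]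
      with x h1 h2 h3 h4
    rw [h1, h2, h3, h4, mul_assoc]
  mul_comm f g := by
    refine ext_ae ?_
    filter_upwards [coe_mul f g, coe_mul g f] with x h1 h2
    rw [h1, h2, mul_comm]

instance : IsScalarTower ℂ (TestFn d) (TestFn d) where
  smul_assoc a f g := by
    refine ext_ae ?_
    filter_upwards [coe_mul (a • f) g, coe_smul a f, coe_smul a (f * g), coe_mul f g]
      with x h1 h2 h3 h4
    change ((a • f) * g).toAE x = (a • (f * g)).toAE x
    rw [h1, h2, h3, h4, mul_assoc]

instance : SMulCommClass ℂ (TestFn d) (TestFn d) where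
  smul_comm a f g := by
    change a • (f * g) = f * (a • g)
    rw [mul_comm f, mul_comm f, smul_mul_assoc]

lemma star_mul (f g : TestFn d) : star (f * g) = star f * star g := by
  refine ext_ae ?_
  filter_upwards [coe_star (f * g), coe_mul f g, coe_mul (star f) (star g), coe_star f,
    coe_star g] with x h1 h2 h3 h4 h5
  rw [h1, h2, h3, h4, h5, map_mul]

lemma integrable_conj_mul (f g : TestFn d) :
    Integrable fun x => conj (f.toAE x) * g.toAE x := by
  have := (g.memLp_two).mul (p := 2) (q := 2) (r := 1) (f.memLp_two.star)
  exact memLp_one_iff_integrable.1 this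

lemma inner_eq (f g : TestFn d) : inner f g = ∫ x, conj (f.toAE x) * g.toAE x := by
  simp [inner, innerPow]

lemma inner_add_right (f g h : TestFn d) : inner f (g + h) = inner f g + inner f h := by
  rw [inner_eq, inner_eq, inner_eq,
    ← integral_add (integrable_conj_mul f g) (integrable_conj_mul f h)]
  refine integral_congr_ae ?_
  filter_upwards [coe_add g h] with x h1
  rw [h1, mul_add]

lemma inner_smul_right (a : ℂ) (f g : TestFn d) : inner f (a • g) = a * inner f g := by
  rw [inner_eq, inner_eq, ← integral_const_mul]
  refine integral_congr_ae ?_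
  filter_upwards [coe_smul a g] with x h1
  rw [h1, mul_left_comm]

lemma inner_add_left (f g h : TestFn d) : inner (f + g) h = inner f h + inner g h := by
  rw [← conj_inner, inner_add_right, map_add, conj_inner, conj_inner]

lemma inner_smul_left (a : ℂ) (f g : TestFn d) : inner (a • f) g = conj a * inner f g := by
  rw [← conj_inner, inner_smul_right, map_mul, conj_inner]

lemma inner_mul_left (a f g : TestFn d) : inner (a * f) g = inner f (star a * g) := by
  rw [inner_eq, inner_eq]
  refine integral_congr_ae ?_
  filter_upwards [coe_mul a f, coe_mul (star a) g, coe_star a] with x h1 h2 h3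
  rw [h1, h2, h3, map_mul]
  ring

/-- The `L²` scalar product, which is definite since test functions are classes modulo almost
everywhere equality. -/
@[reducible]
def innerCore (d : ℕ) : InnerProductSpace.Core ℂ (TestFn d) where
  inner := inner
  conj_inner_symm f g := conj_inner g f
  re_inner_nonneg f := by
    rw [inner_eq, ← integral_re (integrable_conj_mul f f)]
    refine integral_nonneg fun x => ?_
    change 0 ≤ (conj (f.toAE x) * f.toAE x).re
    rw [← Complex.normSq_eq_conj_mul_self, Complex.ofReal_re]
    exact Complex.normSq_nonneg _
  add_left := inner_add_left
  smul_left f g a := inner_smul_left a f g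
  definite f h := by
    change inner f f = 0 at h
    have e : ∀ x, RCLike.re (conj (f.toAE x) * f.toAE x) = Complex.normSq (f.toAE x) :=
      fun x => by
        rw [← Complex.normSq_eq_conj_mul_self]
        exact Complex.ofReal_re _
    have h' := integral_re (integrable_conj_mul f f)
    have hi := (integrable_conj_mul f f).re
    rw [← inner_eq, h, map_zero] at h'
    simp only [e] at h' hi
    have h0 := (integral_eq_zero_iff_of_nonneg (fun x => Complex.normSq_nonneg _) hi).1 h'
    refine ext_ae ?_
    filter_upwards [h0, coe_smul 0 (0 : TestFn d)] with x h1 h2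
    rw [zero_smul] at h2
    rw [h2, zero_mul]
    exact Complex.normSq_eq_zero.1 h1

instance : NormedAddCommGroup (TestFn d) :=
  @InnerProductSpace.Core.toNormedAddCommGroup ℂ (TestFn d) _ _ _ (innerCore d)

instance : InnerProductSpace ℂ (TestFn d) := InnerProductSpace.ofCore (innerCore d).toCore

lemma inner_def (f g : TestFn d) : Inner.inner ℂ f g = inner f g := rfl

lemma coe_iterate_mul (h u : TestFn d) (k : ℕ) :
    ((h * ·)^[k] u).toAE =ᵐ[volume] fun x => h.toAE x ^ k * u.toAE x := by
  induction k with
  | zero => simp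
  | succ k ih =>
    rw [Function.iterate_succ_apply']
    filter_upwards [ih, coe_mul h ((h * ·)^[k] u)] with x h1 h2
    rw [h2, h1, pow_succ', mul_assoc]

/-- `⟨f^{k+1}, g^{k+1}⟩ = ⟨f, (f̄ g)ᵏ g⟩`. -/
lemma inner_iterate_mul (f g : TestFn d) (k : ℕ) :
    inner f ((star f * g * ·)^[k] g) = innerPow (k + 1) f g := by
  rw [inner_eq, innerPow]
  refine integral_congr_ae ?_
  filter_upwards [coe_iterate_mul (star f * g) g k, coe_mul (star f) g, coe_star f]
    with x h1 h2 h3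
  rw [h1, h2, h3, map_pow]
  ring

end TestFn


/-! ### Polarization of symmetric tensors -/

section Polarization

variable {M E : Type*} [AddCommGroup M] [Module ℂ M] [AddCommGroup E] [Module ℂ E] {n : ℕ}

/-- The sum of the values of a multilinear map over all orders of its arguments is a combination
of its values on the diagonal: expanding the right hand side gives a sum over all
`r : Fin n → Fin n`, and inclusion-exclusion leaves the surjective `r`. -/
lemma MultilinearMap.sum_perm_eq_sum_diagonal (F : MultilinearMap ℂ (fun _ : Fin n => M) E)
    (f : Fin n → M) :
    ∑ σ : Equiv.Perm (Fin n), F (fun i => f (σ i)) =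
      ∑ T : Finset (Fin n), (-1 : ℤ) ^ T.card • F (fun _ => ∑ i ∈ Tᶜ, f i) := by
  have h1 : ∀ T : Finset (Fin n), (-1 : ℤ) ^ T.card • F (fun _ => ∑ i ∈ Tᶜ, f i) =
      ∑ r : Fin n → Fin n,
        if T ⊆ (Finset.univ.image r)ᶜ then (-1 : ℤ) ^ T.card • F (fun i => f (r i)) else 0 := by
    intro T
    rw [MultilinearMap.map_sum_finset F (fun _ j => f j) (fun _ => Tᶜ), Finset.smul_sum,
      ← Finset.sum_filter]
    refine Finset.sum_congr ?_ fun _ _ => rfl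
    ext r
    simp only [Fintype.mem_piFinset, Finset.mem_compl, Finset.mem_filter, Finset.mem_univ,
      true_and, Finset.subset_iff, Finset.mem_image, not_exists]
    exact ⟨fun h x hx i hi => h i (hi ▸ hx), fun h i hi => h hi i rfl⟩
  simp_rw [h1]
  rw [Finset.sum_comm]
  have h2 : ∀ r : Fin n → Fin n,
      (∑ T : Finset (Fin n),
        if T ⊆ (Finset.univ.image r)ᶜ then (-1 : ℤ) ^ T.card • F (fun i => f (r i)) else 0) =
      if Function.Bijective r then F (fun i => f (r i)) else 0 := by
    intro r
    rw [← Finset.sum_filter, ← Finset.sum_smul]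
    have : Finset.univ.filter (fun T : Finset (Fin n) => T ⊆ (Finset.univ.image r)ᶜ) =
        (Finset.univ.image r)ᶜ.powerset := by
      ext T; simp
    rw [this, Finset.sum_powerset_neg_one_pow_card]
    have h3 : (Finset.univ.image r)ᶜ = ∅ ↔ Function.Bijective r := by
      rw [Finset.compl_eq_empty_iff, Finset.eq_univ_iff_forall, ← Finite.surjective_iff_bijective]
      simp [Function.Surjective]
    simp only [h3]
    split_ifs <;> simp
  simp_rw [h2]
  rw [← Finset.sum_filter]
  refine Finset.sum_bij (fun σ _ => ⇑σ)
    (fun σ _ => Finset.mem_filter.2 ⟨Finset.mem_univ _, σ.bijective⟩)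
    (fun _ _ _ _ h => DFunLike.coe_injective h)
    (fun r hr => ⟨Equiv.ofBijective r (Finset.mem_filter.1 hr).2, Finset.mem_univ _, rfl⟩)
    fun _ _ => rfl

end Polarization

/-- The sum of all permutations of a tensor is a combination of powers. -/
lemma sum_reindex_mem_span {d n : ℕ} (x : ⨂[ℂ] _ : Fin n, TestFn d) :
    ∑ σ : Equiv.Perm (Fin n), PiTensorProduct.reindex ℂ (fun _ : Fin n => TestFn d) σ x ∈
      Submodule.span ℂ (Set.range fun f : TestFn d =>
        PiTensorProduct.tprod ℂ fun _ : Fin n => f) := by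
  induction x using PiTensorProduct.induction_on with
  | smul_tprod a f =>
    simp only [map_smul, ← Finset.smul_sum]
    refine Submodule.smul_mem _ _ ?_
    have : ∑ σ : Equiv.Perm (Fin n), PiTensorProduct.reindex ℂ (fun _ : Fin n => TestFn d) σ
        (PiTensorProduct.tprod ℂ f) = ∑ σ : Equiv.Perm (Fin n),
          PiTensorProduct.tprod ℂ fun i => f (σ i) := by
      rw [← Equiv.sum_comp (Equiv.inv (Equiv.Perm (Fin n)))]
      refine Finset.sum_congr rfl fun σ _ => ?_
      exact PiTensorProduct.reindex_tprod _ _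
    rw [this, MultilinearMap.sum_perm_eq_sum_diagonal]
    exact Submodule.sum_mem _ fun T _ => zsmul_mem (Submodule.subset_span (Set.mem_range_self _)) _
  | add x y hx hy =>
    simp only [map_add, Finset.sum_add_distrib]
    exact Submodule.add_mem _ hx hy

/-- The symmetric tensors are spanned by the powers `f^{⊗ n}`. -/
lemma span_tensorPow (d n : ℕ) :
    Submodule.span ℂ (Set.range (tensorPow n : TestFn d → symTensor d n)) = ⊤ := by
  refine eq_top_iff.2 fun x _ => ?_
  have h := sum_reindex_mem_span (x : ⨂[ℂ] _ : Fin n, TestFn d)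
  rw [Finset.sum_congr rfl fun σ _ => x.2 σ, Finset.sum_const, ← Nat.cast_smul_eq_nsmul ℂ] at h
  have h0 : ((Finset.univ : Finset (Equiv.Perm (Fin n))).card : ℂ) ≠ 0 := by
    simp [Finset.card_univ]
  have h1 := (Submodule.smul_mem_iff _ h0).1 h
  have e : (Set.range fun f : TestFn d => PiTensorProduct.tprod ℂ fun _ : Fin n => f) =
      (symTensor d n).subtype '' Set.range (tensorPow n) := by
    rw [← Set.range_comp]; rfl
  rw [e, ← Submodule.map_span] at h1
  obtain ⟨y, hy, hyx⟩ := h1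
  rwa [← Subtype.ext hyx]


/-! ### Newton's recursion for sums over partitions -/

/-- The weight `∏ⱼ xⱼ^{iⱼ} / (iⱼ! j^{iⱼ})` of a multiset of positive integers in which `j ≤ n` has
multiplicity `iⱼ`. -/
def cycleWeight (x : ℕ → ℂ) (n : ℕ) (s : Multiset ℕ) : ℂ :=
  ∏ j ∈ Finset.Icc 1 n, x j ^ s.count j / ((s.count j).factorial * (j : ℂ) ^ s.count j)

lemma cycleWeight_cons (x : ℕ → ℂ) {n j : ℕ} (hj : j ∈ Finset.Icc 1 n) (s : Multiset ℕ) :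
    j * (s.count j + 1) * cycleWeight x n (j ::ₘ s) = x j * cycleWeight x n s := by
  unfold cycleWeight
  rw [← Finset.mul_prod_erase _ _ hj, ← Finset.mul_prod_erase _ _ hj]
  have e : ∀ i ∈ (Finset.Icc 1 n).erase j, (j ::ₘ s).count i = s.count i := fun i hi =>
    Multiset.count_cons_of_ne (Finset.ne_of_mem_erase hi) s
  have e' : ∏ i ∈ (Finset.Icc 1 n).erase j, x i ^ (j ::ₘ s).count i /
      (((j ::ₘ s).count i).factorial * (i : ℂ) ^ (j ::ₘ s).count i) =
      ∏ i ∈ (Finset.Icc 1 n).erase j, x i ^ s.count i /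
        ((s.count i).factorial * (i : ℂ) ^ s.count i) :=
    Finset.prod_congr rfl fun i hi => by rw [e i hi]
  rw [e', Multiset.count_cons_self, ← mul_assoc, ← mul_assoc]
  congr 1
  have h1 : (j : ℂ) ≠ 0 := by
    have := (Finset.mem_Icc.1 hj).1
    exact_mod_cast (by omega : j ≠ 0)
  have h2 : ((s.count j).factorial : ℂ) ≠ 0 := by exact_mod_cast Nat.factorial_ne_zero _
  have h3 : (s.count j : ℂ) + 1 ≠ 0 := Nat.cast_add_one_ne_zero _
  rw [Nat.factorial_succ]
  push_cast
  field_simp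
  ring

/-- Parts exceeding `m` have multiplicity `0` in a partition of `m`, so the range of the product
does not matter. -/
lemma cycleWeight_of_le (x : ℕ → ℂ) {m n : ℕ} (h : m ≤ n) (p : Nat.Partition m) :
    cycleWeight x n p.parts = cycleWeight x m p.parts := by
  unfold cycleWeight
  refine (Finset.prod_subset (Finset.Icc_subset_Icc_right h) fun j _ hj => ?_).symm
  rw [Multiset.count_eq_zero_of_notMem]
  · simp
  · intro hp
    exact hj (Finset.mem_Icc.2 ⟨p.parts_pos hp, Nat.Partition.le_of_mem_parts hp⟩)

/-- The sum `∑ ∏ⱼ xⱼ^{iⱼ} / (iⱼ! j^{iⱼ})` over all partitions of `n`: the complete homogeneous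
symmetric function in terms of the power sums `xⱼ`. -/
def cycleSum (x : ℕ → ℂ) (n : ℕ) : ℂ := ∑ p : Nat.Partition n, cycleWeight x n p.parts

/-- Removing a part `j` is a bijection from the partitions of `n` that contain `j` to the partitions
of `n - j`. -/
lemma sum_count_mul_cycleWeight (x : ℕ → ℂ) {n j : ℕ} (hj : j ∈ Finset.Icc 1 n) :
    ∑ p : Nat.Partition n, (j * p.parts.count j : ℂ) * cycleWeight x n p.parts =
      x j * cycleSum x (n - j) := by
  obtain ⟨hj1, hj2⟩ := Finset.mem_Icc.1 hj
  rw [cycleSum, Finset.mul_sum]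
  have h0 : ∀ p ∈ (Finset.univ : Finset (Nat.Partition n)),
      (j * p.parts.count j : ℂ) * cycleWeight x n p.parts ≠ 0 → j ∈ p.parts := by
    intro p _ hp
    by_contra h
    rw [Multiset.count_eq_zero_of_notMem h] at hp
    simp at hp
  rw [← Finset.sum_filter_of_ne h0]
  refine Finset.sum_bij'
    (fun p hp => ⟨p.parts.erase j, fun hi => p.parts_pos (Multiset.mem_of_mem_erase hi), ?_⟩)
    (fun q _ => ⟨j ::ₘ q.parts, fun hi => ?_, ?_⟩) (fun _ _ => Finset.mem_univ _)
    (fun q _ => by simp) ?_ ?_ ?_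
  · have h := Multiset.sum_erase (Finset.mem_filter.1 hp).2
    rw [p.parts_sum] at h
    omega
  · rcases Multiset.mem_cons.1 hi with rfl | hi
    · exact hj1
    · exact q.parts_pos hi
  · rw [Multiset.sum_cons, q.parts_sum]
    omega
  · intro p hp
    exact Nat.Partition.ext (Multiset.cons_erase (Finset.mem_filter.1 hp).2)
  · intro q _
    exact Nat.Partition.ext (Multiset.erase_cons_head _ _)
  · intro p hp
    have h := cycleWeight_cons x hj (p.parts.erase j)
    rw [Multiset.cons_erase (Finset.mem_filter.1 hp).2] at h
    rw [← cycleWeight_of_le x (Nat.sub_le n j) ⟨p.parts.erase j, _, _⟩, ← h,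
      Multiset.count_erase_self,
      Nat.cast_sub (Multiset.one_le_count_iff_mem.2 (Finset.mem_filter.1 hp).2)]
    push_cast
    ring

/-- Newton's identity `n hₙ = ∑ⱼ xⱼ h_{n-j}`, from `n = ∑ⱼ j iⱼ`. -/
lemma cycleSum_succ (x : ℕ → ℂ) (n : ℕ) :
    (n + 1 : ℂ) * cycleSum x (n + 1) =
      ∑ k ∈ Finset.range (n + 1), x (k + 1) * cycleSum x (n - k) := by
  have h1 : ∀ p : Nat.Partition (n + 1),
      (n + 1 : ℂ) = ∑ j ∈ Finset.Icc 1 (n + 1), (j * p.parts.count j : ℂ) := by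
    intro p
    have h := p.parts_sum
    rw [Finset.sum_multiset_count_of_subset p.parts (Finset.Icc 1 (n + 1)) fun j hj => by
      rw [Multiset.mem_toFinset] at hj
      exact Finset.mem_Icc.2 ⟨p.parts_pos hj, Nat.Partition.le_of_mem_parts hj⟩] at h
    have h' := congrArg (Nat.cast : ℕ → ℂ) h
    push_cast at h'
    rw [← h']
    exact Finset.sum_congr rfl fun j _ => by simp [mul_comm]
  have h2 : (n + 1 : ℂ) * cycleSum x (n + 1) =
      ∑ j ∈ Finset.Icc 1 (n + 1), x j * cycleSum x (n + 1 - j) := by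
    rw [cycleSum, Finset.mul_sum,
      Finset.sum_congr rfl fun p _ => by rw [h1 p, Finset.sum_mul], Finset.sum_comm]
    exact Finset.sum_congr rfl fun j hj => sum_count_mul_cycleWeight x hj
  rw [h2, ← Finset.Ico_add_one_right_eq_Icc, Finset.sum_Ico_eq_sum_range]
  refine Finset.sum_congr (by simp) fun k hk => ?_
  rw [add_comm 1 k, Nat.add_sub_add_right]

lemma cycleSum_zero (x : ℕ → ℂ) : cycleSum x 0 = 1 := by
  simp [cycleSum, cycleWeight]

lemma partitionSum_eq {d : ℕ} (c : ℝ) (n : ℕ) (f g : TestFn d) :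
    partitionSum c n f g = (n.factorial : ℂ) ^ 2 * 4 ^ n *
      cycleSum (fun j => (c : ℂ) / 2 * TestFn.innerPow j f g) n := by
  rw [partitionSum, cycleSum, Finset.mul_sum]
  refine Finset.sum_congr rfl fun p _ => ?_
  simp only [cycleWeight, Finset.prod_div_distrib, mul_pow, Finset.prod_mul_distrib,
    Finset.prod_pow_eq_pow_sum, pow_mul]
  norm_num
  ring


/-! ### Existence and uniqueness of the scalar products -/

/-- Splitting an `(m + n)`-tensor into an `m`-tensor and an `n`-tensor. -/
def splitTensor (d m n : ℕ) : (⨂[ℂ] _ : Fin (m + n), TestFn d) ≃ₗ[ℂ]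
    (⨂[ℂ] _ : Fin m, TestFn d) ⊗[ℂ] (⨂[ℂ] _ : Fin n, TestFn d) :=
  PiTensorProduct.reindex ℂ (fun _ => TestFn d) finSumFinEquiv.symm ≪≫ₗ
    (PiTensorProduct.tmulEquiv ℂ (TestFn d)).symm

lemma splitTensor_tprod {d : ℕ} (m n : ℕ) (f : TestFn d) :
    splitTensor d m n (PiTensorProduct.tprod ℂ fun _ => f) =
      (PiTensorProduct.tprod ℂ fun _ => f) ⊗ₜ (PiTensorProduct.tprod ℂ fun _ => f) := by
  rw [splitTensor, LinearEquiv.trans_apply, PiTensorProduct.reindex_tprod]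
  exact PiTensorProduct.tmulEquiv_symm_apply _ _ _

/-- Multiplication `f₁ ⊗ ⋯ ⊗ f_k ↦ f₁ ⋯ f_k` of the entries of a tensor, for `k ≥ 1`. -/
lemma exists_tensor_mul (d k : ℕ) :
    ∃ m : (⨂[ℂ] _ : Fin (k + 1), TestFn d) →ₗ[ℂ] TestFn d,
      (∀ f, (m (PiTensorProduct.tprod ℂ fun _ => f)).toAE =ᵐ[volume]
        fun x => f.toAE x ^ (k + 1)) ∧ (k = 0 → Function.Injective m) := by
  let e1 := PiTensorProduct.subsingletonEquiv (R := ℂ) (s := fun _ => TestFn d) (0 : Fin 1)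
  have he1 : ∀ f : TestFn d, e1 (PiTensorProduct.tprod ℂ fun _ => f) = f := fun f =>
    PiTensorProduct.subsingletonEquiv_apply_tprod _ _
  induction k with
  | zero =>
    refine ⟨e1.toLinearMap, fun f => ?_, fun _ => e1.injective⟩
    rw [LinearEquiv.coe_coe, he1]
    simp
  | succ k ih =>
    obtain ⟨m, hm, -⟩ := ih
    refine ⟨LinearMap.mul' ℂ (TestFn d) ∘ₗ TensorProduct.map m e1.toLinearMap ∘ₗ
      (splitTensor d (k + 1) 1).toLinearMap, fun f => ?_, fun h => by omega⟩
    simp only [LinearMap.comp_apply, LinearEquiv.coe_coe, splitTensor_tprod,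
      TensorProduct.map_tmul, he1, LinearMap.mul'_apply]
    filter_upwards [hm f, TestFn.coe_mul (m (PiTensorProduct.tprod ℂ fun _ => f)) f]
      with x h1 h2
    rw [h2, h1, ← pow_succ]

/-- For a list `l` of positive integers with sum `n`, multiplying consecutive blocks of lengths
`l` maps `n`-tensors linearly to an inner product space, with
`⟨M f^{⊗ n}, M g^{⊗ n}⟩ = ∏_{j ∈ l} ⟨fʲ, gʲ⟩`. If all blocks have length one, nothing is lost. -/
lemma exists_block_map (d : ℕ) {n : ℕ} (l : List ℕ) (hl : ∀ j ∈ l, 0 < j) (hn : l.sum = n) :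
    ∃ (H : Type) (_ : NormedAddCommGroup H) (_ : InnerProductSpace ℂ H)
      (M : (⨂[ℂ] _ : Fin n, TestFn d) →ₗ[ℂ] H),
      (∀ f g, Inner.inner ℂ (M (PiTensorProduct.tprod ℂ fun _ => f))
        (M (PiTensorProduct.tprod ℂ fun _ => g)) =
          (l.map fun j => TestFn.innerPow j f g).prod) ∧
      ((∀ j ∈ l, j = 1) → Function.Injective M) := by
  induction l generalizing n with
  | nil =>
    obtain rfl : 0 = n := by simpa using hn
    refine ⟨ℂ, inferInstance, inferInstance,
      (PiTensorProduct.isEmptyEquiv (R := ℂ) (s := fun _ => TestFn d) (Fin 0)).toLinearMap,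
      fun f g => ?_, fun _ => LinearEquiv.injective _⟩
    simp only [LinearEquiv.coe_coe, PiTensorProduct.isEmptyEquiv_apply_tprod]
    simp
  | cons j l ih =>
    obtain ⟨H, _, _, M, hM, hM'⟩ := ih (fun i hi => hl i (List.mem_cons_of_mem _ hi)) rfl
    obtain ⟨k, rfl⟩ : ∃ k, j = k + 1 :=
      Nat.exists_eq_add_of_le' (hl j List.mem_cons_self)
    obtain rfl : k + 1 + l.sum = n := by simpa using hn
    obtain ⟨m, hm, hm'⟩ := exists_tensor_mul d k
    refine ⟨TestFn d ⊗[ℂ] H, inferInstance, inferInstance,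
      TensorProduct.map m M ∘ₗ (splitTensor d (k + 1) l.sum).toLinearMap, fun f g => ?_,
      fun h => ?_⟩
    · have e : TestFn.inner (m (PiTensorProduct.tprod ℂ fun _ => f))
          (m (PiTensorProduct.tprod ℂ fun _ => g)) = TestFn.innerPow (k + 1) f g := by
        rw [TestFn.inner_eq, TestFn.innerPow]
        refine integral_congr_ae ?_
        filter_upwards [hm f, hm g] with x h1 h2
        rw [h1, h2]
      simp only [LinearMap.comp_apply, LinearEquiv.coe_coe]
      rw [splitTensor_tprod, splitTensor_tprod, TensorProduct.map_tmul, TensorProduct.map_tmul,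
        TensorProduct.inner_tmul, hM, TestFn.inner_def, e, List.map_cons, List.prod_cons]
    · have h1 := hm' (by simpa using h (k + 1) List.mem_cons_self)
      have h2 := hM' fun i hi => h i (List.mem_cons_of_mem _ hi)
      exact (TensorProduct.map_injective_of_flat_flat m M h1 h2).comp (LinearEquiv.injective _)

lemma exists_partition_map (d n : ℕ) (p : Nat.Partition n) :
    ∃ (H : Type) (_ : NormedAddCommGroup H) (_ : InnerProductSpace ℂ H)
      (M : (⨂[ℂ] _ : Fin n, TestFn d) →ₗ[ℂ] H),
      (∀ f g, Inner.inner ℂ (M (PiTensorProduct.tprod ℂ fun _ => f))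
        (M (PiTensorProduct.tprod ℂ fun _ => g)) =
          ∏ j ∈ Finset.Icc 1 n, TestFn.innerPow j f g ^ p.parts.count j) ∧
      ((∀ j ∈ p.parts, j = 1) → Function.Injective M) := by
  obtain ⟨s, hpos, hs⟩ := p
  induction s using Quotient.inductionOn with
  | h l =>
  simp only [Multiset.quot_mk_to_coe, Multiset.sum_coe] at hs
  obtain ⟨H, i1, i2, M, hM, hM'⟩ := exists_block_map d l (fun j hj => hpos (by simpa using hj)) hs
  refine ⟨H, i1, i2, M, fun f g => ?_, fun h => hM' fun j hj => h j (by simpa using hj)⟩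
  rw [hM, ← Multiset.prod_coe, ← Multiset.map_coe, Finset.prod_multiset_map_count]
  refine Finset.prod_subset (fun j hj => ?_) fun j _ hj => ?_
  · have hj' : j ∈ l := by simpa using hj
    exact Finset.mem_Icc.2 ⟨hpos (by simpa using hj'), hs ▸ List.le_sum_of_mem hj'⟩
  · rw [Multiset.mem_toFinset] at hj
    rw [Multiset.count_eq_zero_of_notMem hj, pow_zero]

/-- The scalar product on symmetric `n`-tensors with
`⟨f^{⊗ n}, g^{⊗ n}⟩ = partitionSum c n f g` is a sum of positive semidefinite forms, one for each
partition; the one for `n = 1 + ⋯ + 1` is a positive multiple of the `L²` scalar product of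
tensors, which is definite. -/
lemma exists_scalarProduct (d : ℕ) {c : ℝ} (hc : 0 < c) (n : ℕ) :
    ∃ s : InnerProductSpace.Core ℂ (symTensor d n), ∀ f g : TestFn d,
      s.inner (tensorPow n f) (tensorPow n g) = partitionSum c n f g := by
  choose H i1 i2 M hM hM' using exists_partition_map d n
  let w : Nat.Partition n → ℝ := fun p =>
    (n.factorial : ℝ) ^ 2 * 2 ^ (2 * n) * (c / 2) ^ (∑ j ∈ Finset.Icc 1 n, p.parts.count j)
      / ∏ j ∈ Finset.Icc 1 n, (((p.parts.count j).factorial : ℝ) * (j : ℝ) ^ p.parts.count j)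
  have hw : ∀ p, 0 < w p := by
    intro p
    have h1 : ∀ j ∈ Finset.Icc 1 n,
        (0 : ℝ) < ((p.parts.count j).factorial : ℝ) * (j : ℝ) ^ p.parts.count j := by
      intro j hj
      have : 0 < j := (Finset.mem_Icc.1 hj).1
      positivity
    have h2 := Finset.prod_pos h1
    positivity
  have hre : ∀ (p : Nat.Partition n) (x : symTensor d n),
      (Inner.inner ℂ (M p x) (M p x)).re = ‖M p x‖ ^ 2 := fun p x =>
    inner_self_eq_norm_sq (𝕜 := ℂ) (M p x)
  refine ⟨{
    inner := fun x y => ∑ p, (w p : ℂ) * Inner.inner ℂ (M p x) (M p y)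
    conj_inner_symm := fun x y => by
      rw [map_sum]
      exact Finset.sum_congr rfl fun p _ => by
        rw [map_mul, Complex.conj_ofReal, inner_conj_symm]
    re_inner_nonneg := fun x => by
      rw [map_sum]
      refine Finset.sum_nonneg fun p _ => ?_
      change 0 ≤ ((w p : ℂ) * Inner.inner ℂ (M p x) (M p x)).re
      rw [Complex.re_ofReal_mul, hre]
      exact mul_nonneg (hw p).le (sq_nonneg _)
    add_left := fun x y z => by
      simp only [Submodule.coe_add, map_add, inner_add_left, mul_add, Finset.sum_add_distrib]
    smul_left := fun x y a => by
      simp only [Submodule.coe_smul, map_smul, inner_smul_left, Finset.mul_sum]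
      exact Finset.sum_congr rfl fun p _ => mul_left_comm _ _ _
    definite := fun x h => ?_ }, fun f g => ?_⟩
  · have h' := congrArg Complex.re h
    rw [Complex.re_sum, Complex.zero_re] at h'
    simp only [Complex.re_ofReal_mul, hre] at h'
    rw [Finset.sum_eq_zero_iff_of_nonneg fun p _ => mul_nonneg (hw p).le (sq_nonneg _)] at h'
    -- The partition `1 + ⋯ + 1` alone forces `x = 0`.
    let p : Nat.Partition n := ⟨Multiset.replicate n 1, fun hi => by
      rw [Multiset.eq_of_mem_replicate hi]; exact one_pos, by simp⟩
    have h1 := h' p (Finset.mem_univ p)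
    rw [mul_eq_zero, or_iff_right (hw p).ne', sq_eq_zero_iff, norm_eq_zero] at h1
    have h2 := hM' p (fun j hj => Multiset.eq_of_mem_replicate hj) (h1.trans (map_zero _).symm)
    exact Subtype.ext h2
  · change ∑ p, (w p : ℂ) * Inner.inner ℂ (M p (PiTensorProduct.tprod ℂ fun _ => f))
      (M p (PiTensorProduct.tprod ℂ fun _ => g)) = _
    rw [partitionSum]
    refine Finset.sum_congr rfl fun p _ => ?_
    rw [hM]
    simp [w]

/-- By polarization, sesquilinear forms on symmetric tensors are determined by their values on
powers. -/
lemma sesq_ext {d n : ℕ} {S T : symTensor d n →ₗ⋆[ℂ] symTensor d n →ₗ[ℂ] ℂ}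
    (h : ∀ f g, S (tensorPow n f) (tensorPow n g) = T (tensorPow n f) (tensorPow n g)) :
    S = T := by
  refine LinearMap.ext_on_range (span_tensorPow d n) fun f => ?_
  exact LinearMap.ext_on_range (span_tensorPow d n) fun g => h f g

/-- The scalar product of an inner product core as a sesquilinear map. -/
def InnerProductSpace.Core.toSesq {V : Type*} [AddCommGroup V] [Module ℂ V]
    (s : InnerProductSpace.Core ℂ V) : V →ₗ⋆[ℂ] V →ₗ[ℂ] ℂ :=
  letI := s.toNormedAddCommGroup
  letI : InnerProductSpace ℂ V := InnerProductSpace.ofCore s.toCore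
  innerₛₗ ℂ

lemma InnerProductSpace.Core.toSesq_apply {V : Type*} [AddCommGroup V] [Module ℂ V]
    (s : InnerProductSpace.Core ℂ V) (x y : V) : s.toSesq x y = s.inner x y := rfl

lemma existsUnique_scalarProducts (d : ℕ) {c : ℝ} (hc : 0 < c) :
    ∃! s : ScalarProducts d, ∀ (n : ℕ) (f g : TestFn d),
      (s n).inner (tensorPow n f) (tensorPow n g) = partitionSum c n f g := by
  choose s hs using exists_scalarProduct d hc
  refine ⟨s, hs, fun t ht => funext fun n => ?_⟩
  have h : (t n).toSesq = (s n).toSesq := sesq_ext fun f g => by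
    rw [InnerProductSpace.Core.toSesq_apply, InnerProductSpace.Core.toSesq_apply, ht, hs]
  have h' : (t n).inner = (s n).inner := funext fun x => funext fun y =>
    DFunLike.congr_fun (DFunLike.congr_fun h x) y
  generalize t n = T at h'
  generalize s n = S at h'
  rcases T with ⟨⟨⟨_⟩, _, _, _, _⟩, _⟩
  rcases S with ⟨⟨⟨_⟩, _, _, _, _⟩, _⟩
  cases h'
  rfl


/-! ### A module with a vacuum vector -/

/-- A vacuum functional on `U(RSWN)`: a normalized linear functional that vanishes on the left
ideal generated by the `B_f`, `N_f` and on the right ideal generated by the `B⁺_f`, `N_f`. -/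
structure IsVacuum {d : ℕ} {c : ℝ} (φ : RSWN d c →ₗ[ℂ] ℂ) : Prop where
  map_one : φ 1 = 1
  mul_B : ∀ x f, φ (x * RSWN.B f) = 0
  mul_N : ∀ x f, φ (x * RSWN.N f) = 0
  Bplus_mul : ∀ f x, φ (RSWN.Bplus f * x) = 0
  N_mul : ∀ f x, φ (RSWN.N f * x) = 0

/-- The polynomial algebra in the variables `p_{i,k}`, where `i` runs through a basis of the test
functions. The variables stand for the power sums `h ↦ ∫ conj(h)^{k+1} bᵢ`, functions of a test
function `h`. -/
abbrev PowerSumAlgebra (d : ℕ) : Type :=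
  MvPolynomial (Module.Basis.ofVectorSpaceIndex ℂ (TestFn d) × ℕ) ℂ

namespace PowerSumAlgebra

variable {d : ℕ}

/-- The power sum `p_k(u)`, which stands for the function `h ↦ ∫ conj(h)^{k+1} u`. -/
def powerSum (k : ℕ) : TestFn d →ₗ[ℂ] PowerSumAlgebra d :=
  (Module.Basis.ofVectorSpace ℂ (TestFn d)).constr ℂ fun i => MvPolynomial.X (i, k)

/-- The derivation that maps `p_k(u)` to `T_k(u)`. -/
def der (T : ℕ → TestFn d →ₗ[ℂ] PowerSumAlgebra d) :
    Derivation ℂ (PowerSumAlgebra d) (PowerSumAlgebra d) :=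
  MvPolynomial.mkDerivation ℂ fun x => T x.2 (Module.Basis.ofVectorSpace ℂ (TestFn d) x.1)

lemma powerSum_basis (k : ℕ) (i) :
    powerSum k (Module.Basis.ofVectorSpace ℂ (TestFn d) i) = MvPolynomial.X (i, k) :=
  Module.Basis.constr_basis _ _ _ _

lemma der_powerSum (T : ℕ → TestFn d →ₗ[ℂ] PowerSumAlgebra d) (k : ℕ) (u : TestFn d) :
    der T (powerSum k u) = T k u := by
  have h : (der T).toLinearMap ∘ₗ powerSum k = T k :=
    (Module.Basis.ofVectorSpace ℂ (TestFn d)).ext fun i => by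
      rw [LinearMap.comp_apply, powerSum_basis]
      exact MvPolynomial.mkDerivation_X ℂ _ _
  exact LinearMap.congr_fun h u

lemma derivation_ext {D E : Derivation ℂ (PowerSumAlgebra d) (PowerSumAlgebra d)}
    (h : ∀ k u, D (powerSum k u) = E (powerSum k u)) : D = E :=
  MvPolynomial.derivation_ext fun x => by
    have := h x.2 (Module.Basis.ofVectorSpace ℂ (TestFn d) x.1)
    rwa [powerSum_basis] at this

lemma constantCoeff_powerSum (k : ℕ) (u : TestFn d) :
    MvPolynomial.constantCoeff (powerSum k u) = 0 := by
  have h : (MvPolynomial.aeval fun _ => (0 : ℂ)).toLinearMap ∘ₗ powerSum (d := d) k = 0 :=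
    (Module.Basis.ofVectorSpace ℂ (TestFn d)).ext fun i => by
      rw [LinearMap.comp_apply, powerSum_basis]
      simp
  have := LinearMap.congr_fun h u
  simpa using this

/-- A derivation whose values on the generators have no constant term has no value with a constant
term. -/
lemma constantCoeff_derivation {D : Derivation ℂ (PowerSumAlgebra d) (PowerSumAlgebra d)}
    (h : ∀ k u, MvPolynomial.constantCoeff (D (powerSum k u)) = 0) (F : PowerSumAlgebra d) :
    MvPolynomial.constantCoeff (D F) = 0 := by
  induction F using MvPolynomial.induction_on with
  | C a => rw [MvPolynomial.derivation_C]; simp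
  | add p q hp hq => rw [map_add, map_add, hp, hq, add_zero]
  | mul_X p x hp =>
    have := h x.2 (Module.Basis.ofVectorSpace ℂ (TestFn d) x.1)
    rw [powerSum_basis] at this
    rw [Derivation.leibniz, map_add, smul_eq_mul, smul_eq_mul, map_mul, map_mul, hp, this]
    simp

/-- `B_f` acts as the derivative along `f`. -/
def annihilate (f : TestFn d) : Derivation ℂ (PowerSumAlgebra d) (PowerSumAlgebra d) :=
  der fun k => match k with
    | 0 => (Algebra.linearMap ℂ (PowerSumAlgebra d)) ∘ₗ (innerₛₗ ℂ f)
    | k + 1 => ((k : ℂ) + 2) • powerSum k ∘ₗ LinearMap.mulLeft ℂ (star f)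

/-- `N_a` acts as the derivative along the vector field `h ↦ 2 ā h`. -/
def number (a : TestFn d) : Derivation ℂ (PowerSumAlgebra d) (PowerSumAlgebra d) :=
  der fun k => (2 * ((k : ℂ) + 1)) • powerSum k ∘ₗ LinearMap.mulLeft ℂ a

/-- `B⁺_g` acts as the derivative along the vector field `h ↦ 4 ḡ h²`, plus the multiplication by
`2c p₀(g)`. -/
def createDer (g : TestFn d) : Derivation ℂ (PowerSumAlgebra d) (PowerSumAlgebra d) :=
  der fun k => (4 * ((k : ℂ) + 1)) • powerSum (k + 1) ∘ₗ LinearMap.mulLeft ℂ g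

lemma annihilate_zero (f u : TestFn d) :
    annihilate f (powerSum 0 u) = MvPolynomial.C (TestFn.inner f u) := der_powerSum _ _ _

lemma annihilate_succ (f u : TestFn d) (k : ℕ) :
    annihilate f (powerSum (k + 1) u) = ((k : ℂ) + 2) • powerSum k (star f * u) :=
  der_powerSum _ _ _

lemma number_powerSum (a u : TestFn d) (k : ℕ) :
    number a (powerSum k u) = (2 * ((k : ℂ) + 1)) • powerSum k (a * u) := der_powerSum _ _ _

lemma createDer_powerSum (g u : TestFn d) (k : ℕ) :
    createDer g (powerSum k u) = (4 * ((k : ℂ) + 1)) • powerSum (k + 1) (g * u) :=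
  der_powerSum _ _ _

/-- The operator of `B⁺_g`. -/
def create (c : ℝ) (g : TestFn d) : Module.End ℂ (PowerSumAlgebra d) :=
  (createDer g).toLinearMap + LinearMap.mulLeft ℂ ((2 * (c : ℂ)) • powerSum 0 g)

lemma create_apply (c : ℝ) (g : TestFn d) (F : PowerSumAlgebra d) :
    create c g F = createDer g F + (2 * (c : ℂ)) • (powerSum 0 g * F) := by
  simp [create]

/-- The operators of the generators. -/
def genOp (d : ℕ) (c : ℝ) : RSWNGen d → Module.End ℂ (PowerSumAlgebra d)
  | .bplus f => create c f
  | .b f => (annihilate f).toLinearMap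
  | .num f => (number f).toLinearMap

lemma comm_annihilate_createDer (f g : TestFn d) :
    ⁅annihilate f, createDer g⁆ = (4 : ℂ) • number (star f * g) := by
  refine derivation_ext fun k u => ?_
  rw [Derivation.commutator_apply, Derivation.smul_apply, number_powerSum, createDer_powerSum,
    Derivation.map_smul, annihilate_succ]
  rcases k with - | k
  · rw [annihilate_zero, MvPolynomial.derivation_C, mul_assoc (star f)]
    push_cast
    module
  · rw [annihilate_succ, Derivation.map_smul, createDer_powerSum, mul_left_comm g,
      mul_assoc (star f)]
    push_cast
    module

lemma comm_number_createDer (a g : TestFn d) :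
    ⁅number a, createDer g⁆ = (2 : ℂ) • createDer (a * g) := by
  refine derivation_ext fun k u => ?_
  rw [Derivation.commutator_apply, Derivation.smul_apply, number_powerSum, createDer_powerSum,
    Derivation.map_smul, Derivation.map_smul, createDer_powerSum, createDer_powerSum,
    number_powerSum, mul_left_comm g, mul_assoc a]
  push_cast
  module

lemma comm_annihilate_number (a f : TestFn d) :
    ⁅annihilate f, number (star a)⁆ = (2 : ℂ) • annihilate (a * f) := by
  refine derivation_ext fun k u => ?_
  rw [Derivation.commutator_apply, Derivation.smul_apply, number_powerSum, Derivation.map_smul]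
  rcases k with - | k
  · rw [annihilate_zero, annihilate_zero, annihilate_zero, MvPolynomial.derivation_C,
      TestFn.inner_mul_left]
    push_cast
    module
  · rw [annihilate_succ, annihilate_succ, annihilate_succ, Derivation.map_smul, number_powerSum,
      TestFn.star_mul, mul_left_comm (star f), mul_assoc (star a)]
    push_cast
    module

lemma comm_createDer (f g : TestFn d) : ⁅createDer f, createDer g⁆ = 0 := by
  refine derivation_ext fun k u => ?_
  rw [Derivation.commutator_apply, createDer_powerSum, createDer_powerSum, Derivation.map_smul,
    Derivation.map_smul, createDer_powerSum, createDer_powerSum, mul_left_comm g, sub_self]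
  rfl

lemma comm_number (a b : TestFn d) : ⁅number a, number b⁆ = 0 := by
  refine derivation_ext fun k u => ?_
  rw [Derivation.commutator_apply, number_powerSum, number_powerSum, Derivation.map_smul,
    Derivation.map_smul, number_powerSum, number_powerSum, mul_left_comm b, sub_self]
  rfl

lemma comm_annihilate (f g : TestFn d) : ⁅annihilate f, annihilate g⁆ = 0 := by
  refine derivation_ext fun k u => ?_
  rw [Derivation.commutator_apply, Derivation.zero_apply]
  rcases k with - | _ | k
  · simp [annihilate_zero]
  · simp only [annihilate_succ, annihilate_zero, Derivation.map_smul]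
    rw [← TestFn.inner_mul_left, ← TestFn.inner_mul_left, mul_comm, sub_self]
  · simp only [annihilate_succ, Derivation.map_smul]
    rw [mul_left_comm, sub_self]

/-- The relations hold: both sides are first order operators, and the commutators of the derivations
were computed on power sums. -/
lemma lift_rel {c : ℝ} {x y : FreeAlgebra ℂ (RSWNGen d)} (h : RSWNRel d c x y) :
    FreeAlgebra.lift ℂ (genOp d c) x = FreeAlgebra.lift ℂ (genOp d c) y := by
  have hcomm : ∀ (D E : Derivation ℂ (PowerSumAlgebra d) (PowerSumAlgebra d)) F,
      D (E F) = ⁅D, E⁆ F + E (D F) := fun D E F => by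
    rw [Derivation.commutator_apply, sub_add_cancel]
  cases h with
  | bplus_add f g =>
    simp only [FreeAlgebra.lift_ι_apply, map_add, genOp]
    refine LinearMap.ext fun F => ?_
    have : createDer (f + g) = createDer f + createDer g := derivation_ext fun k u => by
      simp [createDer_powerSum, add_mul]
    simp only [LinearMap.add_apply, create_apply, this, map_add, Derivation.add_apply, add_mul,
      smul_add]
    abel
  | bplus_smul a f =>
    simp only [FreeAlgebra.lift_ι_apply, map_smul, genOp]
    refine LinearMap.ext fun F => ?_
    have : createDer (a • f) = a • createDer f := derivation_ext fun k u => by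
      rw [Derivation.smul_apply, createDer_powerSum, createDer_powerSum, smul_mul_assoc, map_smul,
        smul_comm]
    simp only [LinearMap.smul_apply, create_apply, this, map_smul, Derivation.smul_apply,
      smul_mul_assoc, smul_add, smul_comm a]
  | b_add f g =>
    simp only [FreeAlgebra.lift_ι_apply, map_add, genOp]
    have : annihilate (f + g) = annihilate f + annihilate g := derivation_ext fun k u => by
      rw [Derivation.add_apply]
      rcases k with - | k
      · rw [annihilate_zero, annihilate_zero, annihilate_zero, TestFn.inner_add_left, map_add]
      · rw [annihilate_succ, annihilate_succ, annihilate_succ, TestFn.star_add, add_mul, map_add,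
          smul_add]
    rw [this]
    rfl
  | b_smul a f =>
    simp only [FreeAlgebra.lift_ι_apply, map_smul, genOp]
    have : annihilate (a • f) = conj a • annihilate f := derivation_ext fun k u => by
      rw [Derivation.smul_apply]
      rcases k with - | k
      · rw [annihilate_zero, annihilate_zero, TestFn.inner_smul_left, MvPolynomial.smul_eq_C_mul,
          map_mul]
      · rw [annihilate_succ, annihilate_succ, TestFn.star_smul, smul_mul_assoc, map_smul,
          smul_comm]
    rw [this]
    rfl
  | num_add f g =>
    simp only [FreeAlgebra.lift_ι_apply, map_add, genOp]
    have : number (f + g) = number f + number g := derivation_ext fun k u => by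
      simp [number_powerSum, add_mul]
    rw [this]
    rfl
  | num_smul a f =>
    simp only [FreeAlgebra.lift_ι_apply, map_smul, genOp]
    have : number (a • f) = a • number f := derivation_ext fun k u => by
      rw [Derivation.smul_apply, number_powerSum, number_powerSum, smul_mul_assoc, map_smul,
        smul_comm]
    rw [this]
    rfl
  | comm_b_bplus f g =>
    simp only [FreeAlgebra.lift_ι_apply, map_add, map_sub, map_mul, map_smul, map_one, genOp]
    refine LinearMap.ext fun F => ?_
    simp only [LinearMap.sub_apply, LinearMap.add_apply, LinearMap.smul_apply,
      Module.End.mul_apply, Module.End.one_apply, Derivation.coeFn_coe, create_apply, map_add,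
      Derivation.map_smul, Derivation.leibniz, annihilate_zero, smul_eq_mul]
    rw [hcomm, comm_annihilate_createDer, Derivation.smul_apply, mul_comm F,
      ← MvPolynomial.smul_eq_C_mul]
    module
  | comm_num_bplus a f =>
    simp only [FreeAlgebra.lift_ι_apply, map_sub, map_mul, map_smul, genOp]
    refine LinearMap.ext fun F => ?_
    simp only [LinearMap.sub_apply, LinearMap.smul_apply,
      Module.End.mul_apply, Derivation.coeFn_coe, create_apply, map_add,
      Derivation.map_smul, Derivation.leibniz, number_powerSum, smul_eq_mul]
    rw [hcomm, comm_number_createDer, Derivation.smul_apply, mul_smul_comm, mul_comm F]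
    push_cast
    module
  | comm_b_num a f =>
    simp only [FreeAlgebra.lift_ι_apply, map_sub, map_mul, map_smul, genOp]
    refine LinearMap.ext fun F => ?_
    simp only [LinearMap.sub_apply, LinearMap.smul_apply, Module.End.mul_apply,
      Derivation.coeFn_coe]
    rw [← Derivation.commutator_apply, comm_annihilate_number, Derivation.smul_apply]
  | comm_bplus_bplus f g =>
    simp only [FreeAlgebra.lift_ι_apply, map_sub, map_mul, map_zero, genOp]
    refine LinearMap.ext fun F => ?_
    simp only [LinearMap.sub_apply, LinearMap.zero_apply,
      Module.End.mul_apply, create_apply, map_add,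
      Derivation.map_smul, Derivation.leibniz, createDer_powerSum, smul_eq_mul]
    rw [hcomm, comm_createDer, Derivation.zero_apply, mul_comm f g,
      mul_smul_comm, mul_smul_comm, mul_smul_comm, mul_left_comm (powerSum 0 g)]
    module
  | comm_b_b f g =>
    simp only [FreeAlgebra.lift_ι_apply, map_sub, map_mul, map_zero, genOp]
    refine LinearMap.ext fun F => ?_
    simp only [LinearMap.sub_apply, Module.End.mul_apply, Derivation.coeFn_coe]
    rw [← Derivation.commutator_apply, comm_annihilate]
    rfl
  | comm_num_num a a' =>
    simp only [FreeAlgebra.lift_ι_apply, map_sub, map_mul, map_zero, genOp]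
    refine LinearMap.ext fun F => ?_
    simp only [LinearMap.sub_apply, Module.End.mul_apply, Derivation.coeFn_coe]
    rw [← Derivation.commutator_apply, comm_number]
    rfl

/-- The representation of `U(RSWN)` by first order differential operators. -/
def rep (d : ℕ) (c : ℝ) : RSWN d c →ₐ[ℂ] Module.End ℂ (PowerSumAlgebra d) :=
  RingQuot.liftAlgHom ℂ ⟨FreeAlgebra.lift ℂ (genOp d c), fun _ _ h => lift_rel h⟩

lemma rep_gen (c : ℝ) (x : RSWNGen d) : rep d c (RSWN.gen x) = genOp d c x :=
  (RingQuot.liftAlgHom_mkAlgHom_apply (S := ℂ) _ _ _).trans (FreeAlgebra.lift_ι_apply _ _)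

end PowerSumAlgebra

open PowerSumAlgebra in
/-- The constant term of `x · 1` is a vacuum functional. -/
lemma exists_isVacuum (d : ℕ) (c : ℝ) : ∃ φ : RSWN d c →ₗ[ℂ] ℂ, IsVacuum φ := by
  let ε : PowerSumAlgebra d →ₗ[ℂ] ℂ := (MvPolynomial.aeval fun _ => (0 : ℂ)).toLinearMap
  have hε : ∀ F, ε F = MvPolynomial.constantCoeff F := fun F => by simp [ε]
  refine ⟨ε ∘ₗ LinearMap.applyₗ (1 : PowerSumAlgebra d) ∘ₗ (rep d c).toLinearMap,
    ⟨?_, fun x f => ?_, fun x f => ?_, fun f x => ?_, fun f x => ?_⟩⟩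
  all_goals
    simp only [LinearMap.comp_apply, AlgHom.toLinearMap_apply, LinearMap.applyₗ_apply_apply, hε,
      map_one, map_mul, Module.End.mul_apply, Module.End.one_apply, RSWN.B, RSWN.N, RSWN.Bplus,
      rep_gen, genOp, Derivation.coeFn_coe, Derivation.map_one_eq_zero, map_zero]
  · rw [create_apply, map_add, constantCoeff_derivation fun k u => ?_]
    · simp [MvPolynomial.smul_eq_C_mul, constantCoeff_powerSum]
    · rw [createDer_powerSum, MvPolynomial.smul_eq_C_mul, map_mul, constantCoeff_powerSum,
        mul_zero]
  · refine constantCoeff_derivation (fun k u => ?_) _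
    rw [number_powerSum, MvPolynomial.smul_eq_C_mul, map_mul, constantCoeff_powerSum, mul_zero]


/-! ### Normal ordering in `U(RSWN)` -/

namespace RSWN

variable {d : ℕ} {c : ℝ}

lemma Bplus_add (f g : TestFn d) : (Bplus (f + g) : RSWN d c) = Bplus f + Bplus g := by
  have := mk_rel (RSWNRel.bplus_add (c := c) f g)
  rwa [map_add] at this

lemma Bplus_smul (a : ℂ) (f : TestFn d) : (Bplus (a • f) : RSWN d c) = a • Bplus f := by
  have := mk_rel (RSWNRel.bplus_smul (c := c) a f)
  rwa [map_smul] at this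

lemma B_mul_Bplus (f g : TestFn d) : (B f * Bplus g : RSWN d c) =
    Bplus g * B f + (2 * (c : ℂ) * TestFn.inner f g) • 1 + (4 : ℂ) • N (star f * g) := by
  have := mk_rel (RSWNRel.comm_b_bplus (c := c) f g)
  rw [map_sub, map_add, map_smul, map_smul, map_mul, map_mul, map_one, sub_eq_iff_eq_add',
    ← add_assoc] at this
  exact this

lemma N_mul_Bplus (a f : TestFn d) : (N a * Bplus f : RSWN d c) =
    Bplus f * N a + (2 : ℂ) • Bplus (a * f) := by
  have := mk_rel (RSWNRel.comm_num_bplus (c := c) a f)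
  rwa [map_sub, map_smul, map_mul, map_mul, sub_eq_iff_eq_add'] at this

lemma Bplus_comm (f g : TestFn d) : (Bplus f * Bplus g : RSWN d c) = Bplus g * Bplus f := by
  have := mk_rel (RSWNRel.comm_bplus_bplus (c := c) f g)
  rwa [map_sub, map_mul, map_mul, map_zero, sub_eq_zero] at this

/-- Moving `B_u` to the right through a power of `B⁺_f`. -/
lemma B_mul_Bplus_pow (u f : TestFn d) (m : ℕ) : (B u * Bplus f ^ (m + 2) : RSWN d c) =
    Bplus f ^ (m + 2) * B u + (4 * ((m : ℂ) + 2)) • (Bplus f ^ (m + 1) * N (star u * f)) +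
      (2 * (c : ℂ) * ((m : ℂ) + 2) * TestFn.inner u f) • Bplus f ^ (m + 1) +
      (4 * ((m : ℂ) + 2) * ((m : ℂ) + 1)) • (Bplus (star u * f * f) * Bplus f ^ m) := by
  have hc : ∀ k, (Bplus f ^ k * Bplus (star u * f * f) : RSWN d c) =
      Bplus (star u * f * f) * Bplus f ^ k := fun k =>
    ((show Commute _ _ from Bplus_comm (c := c) f (star u * f * f)).pow_left k).eq
  induction m with
  | zero =>
    rw [zero_add, zero_add, pow_two, ← mul_assoc, B_mul_Bplus, add_mul, add_mul, mul_assoc,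
      B_mul_Bplus, smul_mul_assoc, smul_mul_assoc, N_mul_Bplus]
    simp only [mul_add, mul_smul_comm, mul_one, one_mul, pow_one, pow_zero, mul_assoc,
      Nat.cast_zero]
    module
  | succ m ih =>
    rw [pow_succ, ← mul_assoc, ih]
    simp only [add_mul, smul_mul_assoc]
    rw [mul_assoc (Bplus f ^ (m + 2)), B_mul_Bplus, mul_assoc (Bplus f ^ (m + 1)), N_mul_Bplus,
      mul_assoc (Bplus (star u * f * f)), ← pow_succ, ← pow_succ]
    simp only [mul_add, mul_smul_comm, mul_one, ← mul_assoc, ← pow_succ, hc]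
    push_cast
    module

/-- The left ideal generated by the `B_g` and `N_f`. -/
def annihilators (d : ℕ) (c : ℝ) : Ideal (RSWN d c) :=
  Ideal.span (Set.range B ∪ Set.range N)

/-- The same left ideal as a complex subspace. -/
abbrev annihilatorSpace (d : ℕ) (c : ℝ) : Submodule ℂ (RSWN d c) :=
  (annihilators d c).restrictScalars ℂ

lemma mul_B_mem (x : RSWN d c) (f : TestFn d) : x * B f ∈ annihilatorSpace d c :=
  (annihilators d c).mul_mem_left x (Ideal.subset_span (Or.inl ⟨f, rfl⟩))

lemma mul_N_mem (x : RSWN d c) (f : TestFn d) : x * N f ∈ annihilatorSpace d c :=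
  (annihilators d c).mul_mem_left x (Ideal.subset_span (Or.inr ⟨f, rfl⟩))

lemma mul_mem_annihilatorSpace (x : RSWN d c) {y : RSWN d c} (hy : y ∈ annihilatorSpace d c) :
    x * y ∈ annihilatorSpace d c := (annihilators d c).mul_mem_left x hy

/-- The word `B⁺_{f₁} ⋯ B⁺_{fₙ}`. -/
def word (c : ℝ) (l : List (TestFn d)) : RSWN d c := (l.map Bplus).prod

lemma word_cons (f : TestFn d) (l : List (TestFn d)) : word c (f :: l) = Bplus f * word c l := by
  simp [word]

/-- The span of the words of length `n` in the `B⁺_f`. -/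
def particleSpace (d : ℕ) (c : ℝ) (n : ℕ) : Submodule ℂ (RSWN d c) :=
  Submodule.span ℂ (word c '' {l | l.length = n})

lemma word_mem (l : List (TestFn d)) : word c l ∈ particleSpace d c l.length :=
  Submodule.subset_span ⟨l, rfl, rfl⟩

lemma Bplus_mul_mem (f : TestFn d) {n : ℕ} {x : RSWN d c} (hx : x ∈ particleSpace d c n) :
    Bplus f * x ∈ particleSpace d c (n + 1) := by
  induction hx using Submodule.span_induction with
  | mem x h =>
    obtain ⟨l, rfl, rfl⟩ := h
    rw [← word_cons]
    exact word_mem (f :: l)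
  | zero => rw [mul_zero]; exact zero_mem _
  | add x y _ _ hx hy => rw [mul_add]; exact add_mem hx hy
  | smul a x _ hx => rw [mul_smul_comm]; exact Submodule.smul_mem _ _ hx

lemma Bplus_mul_mem_sup (f : TestFn d) {n : ℕ} {x : RSWN d c}
    (hx : x ∈ particleSpace d c n ⊔ annihilatorSpace d c) :
    Bplus f * x ∈ particleSpace d c (n + 1) ⊔ annihilatorSpace d c := by
  obtain ⟨p, hp, l, hl, rfl⟩ := Submodule.mem_sup.1 hx
  rw [mul_add]
  exact Submodule.add_mem_sup (Bplus_mul_mem f hp) (mul_mem_annihilatorSpace _ hl)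

lemma N_mul_word_mem (a : TestFn d) (l : List (TestFn d)) :
    N a * word c l ∈ particleSpace d c l.length ⊔ annihilatorSpace d c := by
  induction l with
  | nil =>
    refine Submodule.mem_sup_right ?_
    simpa [word] using mul_N_mem (1 : RSWN d c) a
  | cons f l ih =>
    rw [word_cons, ← mul_assoc, N_mul_Bplus, add_mul, mul_assoc, smul_mul_assoc, ← word_cons]
    exact add_mem (Bplus_mul_mem_sup f ih)
      (Submodule.smul_mem _ _ (Submodule.mem_sup_left (word_mem (a * f :: l))))

lemma B_mul_word_mem (u f : TestFn d) (l : List (TestFn d)) :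
    B u * word c (f :: l) ∈ particleSpace d c l.length ⊔ annihilatorSpace d c := by
  induction l generalizing f with
  | nil =>
    have e : B u * word c [f] = Bplus f * B u + (2 * (c : ℂ) * TestFn.inner u f) • word c [] +
        (4 : ℂ) • (1 * N (star u * f)) := by
      simp [word, B_mul_Bplus]
    rw [e]
    exact add_mem (add_mem (Submodule.mem_sup_right (mul_B_mem _ _))
      (Submodule.smul_mem _ _ (Submodule.mem_sup_left (word_mem []))))
      (Submodule.smul_mem _ _ (Submodule.mem_sup_right (mul_N_mem _ _)))
  | cons g l ih =>
    rw [word_cons f, ← mul_assoc, B_mul_Bplus, add_mul, add_mul, mul_assoc, smul_mul_assoc,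
      smul_mul_assoc, one_mul]
    exact add_mem (add_mem (Bplus_mul_mem_sup f (ih g))
      (Submodule.smul_mem _ _ (Submodule.mem_sup_left (word_mem (g :: l)))))
      (Submodule.smul_mem _ _ (N_mul_word_mem _ (g :: l)))

/-- A subspace that contains `1` and is stable under left multiplication by the generators is
everything. -/
lemma eq_top_of_gen_mul_mem {S : Submodule ℂ (RSWN d c)} (h1 : 1 ∈ S)
    (h : ∀ x, ∀ y ∈ S, gen x * y ∈ S) : S = ⊤ := by
  have key : ∀ z : FreeAlgebra ℂ (RSWNGen d), ∀ y ∈ S, mk d c z * y ∈ S := by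
    intro z
    induction z using FreeAlgebra.induction with
    | grade0 a =>
      intro y hy
      rw [AlgHom.commutes, ← Algebra.smul_def]
      exact S.smul_mem a hy
    | grade1 x => exact h x
    | mul p q hp hq =>
      intro y hy
      rw [map_mul, mul_assoc]
      exact hp _ (hq _ hy)
    | add p q hp hq =>
      intro y hy
      rw [map_add, add_mul]
      exact add_mem (hp _ hy) (hq _ hy)
  refine eq_top_iff.2 fun x _ => ?_
  obtain ⟨z, rfl⟩ := RingQuot.mkAlgHom_surjective ℂ (RSWNRel d c) x
  have := key z 1 h1
  rwa [mul_one] at this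

/-- Normal ordering: modulo the left ideal of annihilators every element is a polynomial in the
`B⁺_f`. -/
lemma iSup_particleSpace_sup (d : ℕ) (c : ℝ) :
    (⨆ n, particleSpace d c n) ⊔ annihilatorSpace d c = ⊤ := by
  have hle : ∀ n, particleSpace d c n ⊔ annihilatorSpace d c ≤
      (⨆ n, particleSpace d c n) ⊔ annihilatorSpace d c := fun n =>
    sup_le_sup_right (le_iSup _ n) _
  refine eq_top_of_gen_mul_mem (hle 0 (Submodule.mem_sup_left (word_mem []))) fun x y hy => ?_
  obtain ⟨p, hp, l, hl, rfl⟩ := Submodule.mem_sup.1 hy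
  rw [mul_add]
  refine add_mem ?_ (Submodule.mem_sup_right (mul_mem_annihilatorSpace _ hl))
  induction hp using Submodule.iSup_induction' with
  | zero => rw [mul_zero]; exact zero_mem _
  | add p q hp' hq' hp hq =>
    rw [mul_add]
    exact add_mem (hp (Submodule.add_mem_sup hp' hl)) (hq (Submodule.add_mem_sup hq' hl))
  | mem n p hp =>
    clear hy
    induction hp using Submodule.span_induction with
    | zero => rw [mul_zero]; exact zero_mem _
    | add x y _ _ hx hy => rw [mul_add]; exact add_mem hx hy
    | smul a x _ hx => rw [mul_smul_comm]; exact Submodule.smul_mem _ _ hx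
    | mem p h =>
      obtain ⟨l, rfl, rfl⟩ := h
      cases x with
      | bplus f => exact hle _ (Submodule.mem_sup_left (Bplus_mul_mem f (word_mem l)))
      | num f => exact hle _ (N_mul_word_mem f l)
      | b f =>
        cases l with
        | nil =>
          refine Submodule.mem_sup_right ?_
          have := mul_B_mem (1 : RSWN d c) f
          rw [one_mul] at this
          rwa [show word c [] = (1 : RSWN d c) from rfl, mul_one]
        | cons g l => exact hle _ (B_mul_word_mem f g l)

/-- The linear map `f₁ ⊗ ⋯ ⊗ fₙ ↦ B⁺_{f₁} ⋯ B⁺_{fₙ}`. -/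
def tensorWord (c : ℝ) (n : ℕ) : (⨂[ℂ] _ : Fin n, TestFn d) →ₗ[ℂ] RSWN d c :=
  PiTensorProduct.lift ((MultilinearMap.mkPiAlgebraFin ℂ n (RSWN d c)).compLinearMap fun _ =>
    { toFun := Bplus, map_add' := Bplus_add, map_smul' := Bplus_smul })

lemma tensorWord_tprod (n : ℕ) (f : Fin n → TestFn d) :
    tensorWord c n (PiTensorProduct.tprod ℂ f) = word c (List.ofFn f) := by
  rw [tensorWord, PiTensorProduct.lift.tprod, MultilinearMap.compLinearMap_apply,
    MultilinearMap.mkPiAlgebraFin_apply, word, List.map_ofFn]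
  rfl

/-- The map `f^{⊗ n} ↦ B⁺ⁿ_f` on symmetric tensors. -/
def symWord (c : ℝ) (n : ℕ) : symTensor d n →ₗ[ℂ] RSWN d c :=
  tensorWord c n ∘ₗ (symTensor d n).subtype

lemma symWord_tensorPow (n : ℕ) (f : TestFn d) : symWord c n (tensorPow n f) = Bplus f ^ n := by
  refine (tensorWord_tprod n _).trans ?_
  simp [word]

lemma tensorWord_reindex (n : ℕ) (σ : Equiv.Perm (Fin n)) (x : ⨂[ℂ] _ : Fin n, TestFn d) :
    tensorWord c n (PiTensorProduct.reindex ℂ (fun _ : Fin n => TestFn d) σ x) =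
      tensorWord c n x := by
  induction x using PiTensorProduct.induction_on with
  | smul_tprod a f =>
    rw [map_smul, map_smul, map_smul]
    congr 1
    refine (congrArg _ (PiTensorProduct.reindex_tprod σ f)).trans ?_
    rw [tensorWord_tprod, tensorWord_tprod, word, word]
    refine List.Perm.prod_eq' ((Equiv.Perm.ofFn_comp_perm σ.symm f).map _) ?_
    refine List.pairwise_of_forall_mem_list ?_
    intro x hx y hy
    obtain ⟨f, -, rfl⟩ := List.mem_map.1 hx
    obtain ⟨g, -, rfl⟩ := List.mem_map.1 hy
    exact Bplus_comm f g
  | add x y hx hy => rw [map_add, map_add, map_add, hx, hy]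

/-- Since the `B⁺_f` commute, words are values of symmetric tensors. -/
lemma particleSpace_le_range (n : ℕ) : particleSpace d c n ≤ LinearMap.range (symWord c n) := by
  rw [particleSpace, Submodule.span_le]
  rintro _ ⟨l, rfl, rfl⟩
  let x : ⨂[ℂ] _ : Fin l.length, TestFn d := PiTensorProduct.tprod ℂ l.get
  let y : symTensor d l.length :=
    ⟨∑ σ : Equiv.Perm (Fin l.length),
      PiTensorProduct.reindex ℂ (fun _ : Fin l.length => TestFn d) σ x, fun τ => by
        rw [map_sum]
        refine Fintype.sum_equiv (Equiv.mulLeft τ) _ _ fun σ => ?_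
        exact PiTensorProduct.reindex_reindex σ τ x⟩
  have hy : symWord c _ y = (l.length.factorial : ℂ) • word c l := by
    change tensorWord c _ (∑ σ : Equiv.Perm (Fin l.length), _) = _
    rw [map_sum, Finset.sum_congr rfl fun σ _ => tensorWord_reindex _ σ x, Finset.sum_const,
      Finset.card_univ, Fintype.card_perm, Fintype.card_fin, tensorWord_tprod, List.ofFn_get,
      Nat.cast_smul_eq_nsmul]
  refine ⟨(l.length.factorial : ℂ)⁻¹ • y, ?_⟩
  rw [map_smul, hy, inv_smul_smul₀]
  exact_mod_cast Nat.factorial_ne_zero _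

end RSWN


/-! ### The vacuum functional -/

namespace RSWN

variable {d : ℕ} {c : ℝ}

lemma B_mul_mem (u : TestFn d) {n : ℕ} {x : RSWN d c} (hx : x ∈ particleSpace d c (n + 1)) :
    B u * x ∈ particleSpace d c n ⊔ annihilatorSpace d c := by
  induction hx using Submodule.span_induction with
  | mem x h =>
    obtain ⟨_ | ⟨f, l⟩, hl, rfl⟩ := h
    · exact absurd hl (Nat.succ_ne_zero n).symm
    · obtain rfl : l.length = n := Nat.succ_injective hl
      exact B_mul_word_mem u f l
  | zero => rw [mul_zero]; exact zero_mem _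
  | add x y _ _ hx hy => rw [mul_add]; exact add_mem hx hy
  | smul a x _ hx => rw [mul_smul_comm]; exact Submodule.smul_mem _ _ hx

lemma B_mul_mem_zero (u : TestFn d) {x : RSWN d c} (hx : x ∈ particleSpace d c 0) :
    B u * x ∈ annihilatorSpace d c := by
  induction hx using Submodule.span_induction with
  | mem x h =>
    obtain ⟨l, hl, rfl⟩ := h
    obtain rfl := List.length_eq_zero_iff.1 hl
    rw [show word c [] = (1 : RSWN d c) from rfl, mul_one, ← one_mul (B u)]
    exact mul_B_mem _ _
  | zero => rw [mul_zero]; exact zero_mem _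
  | add x y _ _ hx hy => rw [mul_add]; exact add_mem hx hy
  | smul a x _ hx => rw [mul_smul_comm]; exact Submodule.smul_mem _ _ hx

lemma symWord_mem (n : ℕ) (x : symTensor d n) : symWord c n x ∈ particleSpace d c n := by
  have h : (⊤ : Submodule ℂ (symTensor d n)) ≤ (particleSpace d c n).comap (symWord c n) := by
    rw [← span_tensorPow, Submodule.span_le]
    rintro _ ⟨f, rfl⟩
    change symWord c n (tensorPow n f) ∈ particleSpace d c n
    rw [symWord_tensorPow]
    have := word_mem (c := c) (List.replicate n f)
    rwa [word, List.map_replicate, List.prod_replicate, List.length_replicate] at this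
  exact h Submodule.mem_top

/-- Modulo annihilators, `U(RSWN)` is spanned by the powers of the `B⁺_f`: normal ordering and
polarization. -/
lemma eq_top_of_pow_mem {S : Submodule ℂ (RSWN d c)} (h1 : ∀ n f, Bplus f ^ n ∈ S)
    (h2 : annihilatorSpace d c ≤ S) : S = ⊤ := by
  rw [eq_top_iff, ← iSup_particleSpace_sup]
  refine sup_le (iSup_le fun n => (particleSpace_le_range n).trans ?_) h2
  rw [LinearMap.range_eq_map, ← span_tensorPow, Submodule.map_span, Submodule.span_le]
  rintro _ ⟨_, ⟨f, rfl⟩, rfl⟩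
  rw [symWord_tensorPow]
  exact h1 n f

end RSWN

namespace IsVacuum

open RSWN

variable {d : ℕ} {c : ℝ} {φ ψ : RSWN d c →ₗ[ℂ] ℂ}

lemma mul_annihilator (hφ : IsVacuum φ) (x : RSWN d c) {y : RSWN d c}
    (hy : y ∈ annihilatorSpace d c) : φ (x * y) = 0 := by
  have hy' : y ∈ Submodule.span (RSWN d c) (Set.range B ∪ Set.range N) := hy
  induction hy' using Submodule.span_induction generalizing x with
  | mem y h =>
    rcases h with ⟨f, rfl⟩ | ⟨f, rfl⟩
    · exact hφ.mul_B x f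
    · exact hφ.mul_N x f
  | zero => rw [mul_zero, map_zero]
  | add y z hy' hz' ihy ihz => rw [mul_add, map_add, ihy _ hy', ihz _ hz', add_zero]
  | smul a y hy' ih => rw [smul_eq_mul, ← mul_assoc, ih _ hy']

lemma annihilator (hφ : IsVacuum φ) {y : RSWN d c} (hy : y ∈ annihilatorSpace d c) : φ y = 0 := by
  have := hφ.mul_annihilator 1 hy
  rwa [one_mul] at this

/-- There is at most one vacuum functional. -/
lemma unique (hφ : IsVacuum φ) (hψ : IsVacuum ψ) : φ = ψ := by
  have h : LinearMap.eqLocus φ ψ = ⊤ := by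
    rw [eq_top_iff, ← iSup_particleSpace_sup]
    refine sup_le (iSup_le fun n => ?_) fun y hy => ?_
    · rw [particleSpace, Submodule.span_le]
      rintro _ ⟨_ | ⟨f, l⟩, -, rfl⟩
      · exact hφ.map_one.trans hψ.map_one.symm
      · rw [word_cons]
        exact (hφ.Bplus_mul _ _).trans (hψ.Bplus_mul _ _).symm
    · exact (hφ.annihilator hy).trans (hψ.annihilator hy).symm
  exact LinearMap.ext fun x => (h ▸ Submodule.mem_top : x ∈ LinearMap.eqLocus φ ψ)

/-- The vacuum functional is hermitian, since `x ↦ conj φ(x*)` is a vacuum functional as well. -/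
lemma conj_apply (hφ : IsVacuum φ) (x : RSWN d c) : conj (φ x) = φ (star x) := by
  let ψ : RSWN d c →ₗ[ℂ] ℂ :=
    { toFun := fun x => conj (φ (star x))
      map_add' := fun x y => by rw [star_add, map_add, map_add]
      map_smul' := fun a x => by
        rw [star_smul, map_smul, smul_eq_mul, map_mul]
        simp }
  have hψ : IsVacuum ψ :=
    { map_one := by
        change conj (φ (star 1)) = 1
        rw [star_one, hφ.map_one, RingHom.map_one]
      mul_B := fun x f => by
        change conj (φ (star (x * B f))) = 0
        rw [star_mul, star_B, hφ.Bplus_mul, map_zero]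
      mul_N := fun x f => by
        change conj (φ (star (x * N f))) = 0
        rw [star_mul, star_N, hφ.N_mul, map_zero]
      Bplus_mul := fun f x => by
        change conj (φ (star (Bplus f * x))) = 0
        rw [star_mul, star_Bplus, hφ.mul_B, map_zero]
      N_mul := fun f x => by
        change conj (φ (star (N f * x))) = 0
        rw [star_mul, star_N, hφ.mul_N, map_zero] }
  have h : φ (star x) = conj (φ (star (star x))) := LinearMap.congr_fun (hφ.unique hψ) (star x)
  rw [h, _root_.star_star]

/-- Vectors with different numbers of particles are orthogonal. -/
lemma star_mul_eq_zero (hφ : IsVacuum φ) {m n : ℕ} (hmn : m ≠ n) {x y : RSWN d c}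
    (hx : x ∈ particleSpace d c m) (hy : y ∈ particleSpace d c n) : φ (star x * y) = 0 := by
  induction hx using Submodule.span_induction with
  | mem x h =>
    obtain ⟨l, rfl, rfl⟩ := h
    induction l generalizing n y with
    | nil =>
      rw [show word c [] = (1 : RSWN d c) from rfl, star_one, one_mul]
      induction hy using Submodule.span_induction with
      | mem y h =>
        obtain ⟨_ | ⟨f, l⟩, rfl, rfl⟩ := h
        · exact absurd rfl hmn
        · rw [word_cons, hφ.Bplus_mul]
      | zero => exact map_zero φ
      | add y z _ _ hy hz => rw [map_add, hy, hz, add_zero]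
      | smul a y _ hy => rw [map_smul, hy, smul_zero]
    | cons f l ih =>
      rw [word_cons, star_mul, star_Bplus, mul_assoc]
      rcases n with - | n
      · exact hφ.mul_annihilator _ (B_mul_mem_zero f hy)
      · obtain ⟨p, hp, q, hq, hpq⟩ := Submodule.mem_sup.1 (B_mul_mem f hy)
        rw [← hpq, mul_add, map_add, hφ.mul_annihilator _ hq, add_zero]
        exact ih hp fun e => hmn (congrArg Nat.succ e)
  | zero => rw [star_zero, zero_mul, map_zero]
  | add x z _ _ hx hz => rw [star_add, add_mul, map_add, hx, hz, add_zero]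
  | smul a x _ hx => rw [star_smul, smul_mul_assoc, map_smul, hx, smul_zero]

/-! ### Scalar products of powers -/

/-- `φ(B_f^{m+1} B⁺_u B⁺_g^m)`, normalized. -/
def leftMoment (φ : RSWN d c →ₗ[ℂ] ℂ) (f g : TestFn d) (m : ℕ) (u : TestFn d) : ℂ :=
  φ (B f ^ (m + 1) * (Bplus u * Bplus g ^ m)) /
    (((m + 1).factorial : ℂ) * m.factorial * 4 ^ (m + 1))

/-- `φ(B_f^m B_w B⁺_g^{m+1})`, normalized. -/
def rightMoment (φ : RSWN d c →ₗ[ℂ] ℂ) (f g : TestFn d) (m : ℕ) (w : TestFn d) : ℂ :=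
  φ (B f ^ m * (B w * Bplus g ^ (m + 1))) /
    (((m + 1).factorial : ℂ) * m.factorial * 4 ^ (m + 1))

/-- `φ(B_f^m B⁺_g^m)`, normalized. -/
def moment (φ : RSWN d c →ₗ[ℂ] ℂ) (f g : TestFn d) (m : ℕ) : ℂ :=
  φ (B f ^ m * Bplus g ^ m) / ((m.factorial : ℂ) ^ 2 * 4 ^ m)

lemma rightMoment_zero (hφ : IsVacuum φ) (f g w : TestFn d) :
    rightMoment φ f g 0 w = (c : ℂ) / 2 * (TestFn.inner w g * moment φ f g 0) := by
  simp only [rightMoment, moment, pow_zero, one_mul, zero_add, pow_one, B_mul_Bplus, map_add,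
    hφ.Bplus_mul, map_smul, hφ.map_one]
  have := hφ.mul_N 1 (star w * g)
  rw [one_mul] at this
  rw [this]
  simp
  ring

/-- Moving `B_w` to the right. -/
lemma rightMoment_succ (hφ : IsVacuum φ) (f g w : TestFn d) (m : ℕ) :
    rightMoment φ f g (m + 1) w = (c : ℂ) / 2 * (TestFn.inner w g * moment φ f g (m + 1)) +
      leftMoment φ f g m (star w * g * g) := by
  have h1 : (m.factorial : ℂ) ≠ 0 := by exact_mod_cast Nat.factorial_ne_zero _
  have h2 : (m : ℂ) + 1 ≠ 0 := Nat.cast_add_one_ne_zero _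
  have h3 : (m : ℂ) + 1 + 1 ≠ 0 := by
    have := Nat.cast_add_one_ne_zero (R := ℂ) (m + 1)
    rwa [Nat.cast_add_one] at this
  rw [rightMoment, moment, leftMoment, B_mul_Bplus_pow]
  simp only [mul_add, mul_smul_comm, map_add, map_smul, ← mul_assoc, hφ.mul_B, hφ.mul_N,
    smul_eq_mul, Nat.factorial_succ]
  push_cast
  field_simp
  ring

/-- Taking adjoints exchanges the two moments. -/
lemma leftMoment_eq_conj (hφ : IsVacuum φ) (f g u : TestFn d) (m : ℕ) :
    leftMoment φ f g m u = conj (rightMoment φ g f m u) := by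
  rw [leftMoment, rightMoment, map_div₀, hφ.conj_apply]
  simp only [star_mul, star_pow, star_B, star_Bplus, mul_assoc, map_mul, map_pow, map_natCast,
    Complex.conj_ofNat]

lemma moment_conj (hφ : IsVacuum φ) (f g : TestFn d) (m : ℕ) :
    conj (moment φ f g m) = moment φ g f m := by
  rw [moment, moment, map_div₀, hφ.conj_apply]
  simp only [star_mul, star_pow, star_B, star_Bplus, map_mul, map_pow, map_natCast,
    Complex.conj_ofNat]

/-- The solution of the recursion: applying `rightMoment_succ` and its adjoint in turn replaces `w` by
`w̄ g²`, then by `f² ḡ² w`, and so on. -/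
lemma rightMoment_eq_sum (hφ : IsVacuum φ) (f g w : TestFn d) (m : ℕ) :
    rightMoment φ f g m w = (c : ℂ) / 2 * ∑ k ∈ Finset.range (m + 1),
      TestFn.inner w ((star f * g * ·)^[k] g) * moment φ f g (m - k) := by
  induction m generalizing f g w with
  | zero => simp [rightMoment_zero hφ]
  | succ m ih =>
    rw [rightMoment_succ hφ, leftMoment_eq_conj hφ, ih, Finset.sum_range_succ' _ (m + 1)]
    simp only [map_mul, map_sum, map_div₀, Complex.conj_ofReal, Complex.conj_ofNat,
      moment_conj hφ, TestFn.conj_inner, Nat.add_sub_add_right, Nat.sub_zero,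
      Function.iterate_zero, id]
    rw [mul_add, add_comm]
    congr 2
    refine Finset.sum_congr rfl fun k _ => ?_
    congr 1
    rw [TestFn.inner_eq, TestFn.inner_eq]
    refine integral_congr_ae ?_
    filter_upwards [TestFn.coe_iterate_mul (star g * f) f k,
      TestFn.coe_iterate_mul (star f * g) g (k + 1), TestFn.coe_mul (star f) g,
      TestFn.coe_mul (star g) f, TestFn.coe_mul (star w * g) g, TestFn.coe_mul (star w) g,
      TestFn.coe_star f, TestFn.coe_star g, TestFn.coe_star w] with x h1 h2 h3 h4 h5 h6 h7 h8 h9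
    rw [h1, h2, h3, h4, h5, h6, h7, h8, h9]
    simp only [map_mul, map_pow, Complex.conj_conj]
    ring

lemma moment_zero (hφ : IsVacuum φ) (f g : TestFn d) : moment φ f g 0 = 1 := by
  simp [moment, hφ.map_one]

lemma moment_succ (hφ : IsVacuum φ) (f g : TestFn d) (m : ℕ) :
    (m + 1 : ℂ) * moment φ f g (m + 1) = ∑ k ∈ Finset.range (m + 1),
      (c : ℂ) / 2 * TestFn.innerPow (k + 1) f g * moment φ f g (m - k) := by
  have h1 : (m.factorial : ℂ) ≠ 0 := by exact_mod_cast Nat.factorial_ne_zero _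
  have h2 : (m : ℂ) + 1 ≠ 0 := Nat.cast_add_one_ne_zero _
  have h := rightMoment_eq_sum hφ f g f m
  rw [Finset.mul_sum] at h
  simp only [TestFn.inner_iterate_mul, ← mul_assoc] at h
  rw [← h, moment, rightMoment, ← mul_assoc, ← pow_succ, Nat.factorial_succ]
  push_cast
  field_simp

/-- The scalar products of powers: both sides satisfy Newton's recursion. -/
lemma apply_B_pow_mul_Bplus_pow (hφ : IsVacuum φ) (n : ℕ) (f g : TestFn d) :
    φ (B f ^ n * Bplus g ^ n) = partitionSum c n f g := by
  have h : moment φ f g n = cycleSum (fun j => (c : ℂ) / 2 * TestFn.innerPow j f g) n := by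
    induction n using Nat.strong_induction_on with
    | _ n ih =>
      rcases n with - | n
      · rw [moment_zero hφ, cycleSum_zero]
      · refine mul_left_cancel₀ (Nat.cast_add_one_ne_zero (R := ℂ) n) ?_
        rw [moment_succ hφ, cycleSum_succ]
        refine Finset.sum_congr rfl fun k _ => ?_
        rw [ih (n - k) (by omega)]
  rw [partitionSum_eq, ← h, moment]
  have h1 : (n.factorial : ℂ) ≠ 0 := by exact_mod_cast Nat.factorial_ne_zero _
  field_simp

/-- The vacuum functional on symmetric tensors is the scalar product. -/
lemma apply_symWord (hφ : IsVacuum φ) {s : ScalarProducts d}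
    (hs : ∀ (n : ℕ) (f g : TestFn d),
      (s n).inner (tensorPow n f) (tensorPow n g) = partitionSum c n f g)
    (n : ℕ) (x y : symTensor d n) :
    φ (star (symWord c n x) * symWord c n y) = (s n).inner x y := by
  let S : symTensor d n →ₗ⋆[ℂ] symTensor d n →ₗ[ℂ] ℂ :=
    LinearMap.mk₂'ₛₗ (starRingEnd ℂ) (RingHom.id ℂ)
      (fun x y => φ (star (symWord c n x) * symWord c n y))
      (fun x x' y => by rw [map_add, star_add, add_mul, map_add])
      (fun a x y => by rw [map_smul, star_smul, smul_mul_assoc, map_smul]; rfl)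
      (fun x y y' => by rw [map_add, mul_add, map_add])
      (fun a x y => by rw [map_smul, mul_smul_comm, map_smul]; rfl)
  have h : S = (s n).toSesq := sesq_ext fun f g => by
    rw [InnerProductSpace.Core.toSesq_apply, hs]
    change φ (star (symWord c n (tensorPow n f)) * symWord c n (tensorPow n g)) = _
    rw [symWord_tensorPow, symWord_tensorPow, star_pow, star_Bplus,
      apply_B_pow_mul_Bplus_pow hφ]
  exact DFunLike.congr_fun (DFunLike.congr_fun h x) y

/-- Positivity: modulo annihilators, `x` is a sum of images of symmetric tensors `yₙ`, and
`φ(x* x)` is the sum of their squared norms. -/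
lemma apply_star_mul_self_nonneg (hφ : IsVacuum φ) (hc : 0 < c) (x : RSWN d c) :
    0 ≤ (φ (star x * x)).re := by
  obtain ⟨s, hs, -⟩ := existsUnique_scalarProducts d hc
  obtain ⟨p, hp, q, hq, rfl⟩ := Submodule.mem_sup.1
    (iSup_particleSpace_sup d c ▸ Submodule.mem_top :
      x ∈ (⨆ n, particleSpace d c n) ⊔ annihilatorSpace d c)
  have h1 : φ (star (p + q) * (p + q)) = φ (star p * p) := by
    have h2 : φ (star q * p) = 0 := by
      have := hφ.conj_apply (star p * q)
      rwa [hφ.mul_annihilator _ hq, map_zero, star_mul, _root_.star_star, eq_comm] at this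
    rw [mul_add, map_add, hφ.mul_annihilator _ hq, star_add, add_mul, map_add, h2, add_zero,
      add_zero]
  rw [h1]
  obtain ⟨v, hv, rfl⟩ := (Submodule.mem_iSup_iff_exists_finsupp _ _).1 hp
  rw [Finsupp.sum, star_sum, Finset.sum_mul, map_sum, Complex.re_sum]
  refine Finset.sum_nonneg fun n hn => ?_
  rw [Finset.mul_sum, map_sum, Finset.sum_eq_single_of_mem n hn fun m _ hmn =>
    hφ.star_mul_eq_zero hmn.symm (hv n) (hv m)]
  obtain ⟨y, hy⟩ := particleSpace_le_range n (hv n)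
  rw [← hy, hφ.apply_symWord hs]
  exact (s n).re_inner_nonneg y

/-- The quadratic Fock state. -/
def toState (hφ : IsVacuum φ) (hc : 0 < c) : AlgState (RSWN d c) where
  toFun := φ
  map_one := hφ.map_one
  nonneg_re := hφ.apply_star_mul_self_nonneg hc
  im_eq_zero x := by
    rw [← Complex.conj_eq_iff_im, hφ.conj_apply, star_mul, _root_.star_star]

end IsVacuum

lemma AlgState.IsQuadraticFock.isVacuum {d : ℕ} {c : ℝ} {φ : AlgState (RSWN d c)}
    (hφ : φ.IsQuadraticFock) : IsVacuum φ.toFun where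
  map_one := φ.map_one
  mul_B := hφ.1
  mul_N := hφ.2
  Bplus_mul f x := by
    rw [← star_star (RSWN.Bplus f * x), ← φ.conj_apply, star_mul, RSWN.star_Bplus, hφ.1, map_zero]
  N_mul f x := by
    rw [← star_star (RSWN.N f * x), ← φ.conj_apply, star_mul, RSWN.star_N, hφ.2, map_zero]

lemma existsUnique_isQuadraticFock (d : ℕ) {c : ℝ} (hc : 0 < c) :
    ∃! φ : AlgState (RSWN d c), φ.IsQuadraticFock := by
  obtain ⟨φ, hφ⟩ := exists_isVacuum d c
  refine ⟨hφ.toState hc, ⟨hφ.mul_B, hφ.mul_N⟩, fun ψ hψ => ?_⟩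
  exact AlgState.ext (hψ.isVacuum.unique hφ)

/-! ### The interacting Fock space -/

section GNS

open RSWN

variable {d : ℕ} {c : ℝ} {φ : AlgState (RSWN d c)} {s : ScalarProducts d}

/-- The map `x ↦ xΦ` as a linear map. -/
def AlgState.vecLinear {U : Type} [Ring U] [StarRing U] [Algebra ℂ U] [StarModule ℂ U]
    (φ : AlgState U) : U →ₗ[ℂ] φ.GNS :=
  (UniformSpace.Completion.toComplₗᵢ (𝕜 := ℂ) (E := φ.PreGNS)).toLinearMap

lemma AlgState.vecLinear_apply {U : Type} [Ring U] [StarRing U] [Algebra ℂ U] [StarModule ℂ U]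
    (φ : AlgState U) (x : U) : φ.vecLinear x = φ.vec x := rfl

/-- A linear map that preserves scalar products extends to the completion. -/
def completionIsometry {E H : Type*} [NormedAddCommGroup E] [InnerProductSpace ℂ E]
    [NormedAddCommGroup H] [InnerProductSpace ℂ H] [CompleteSpace H] (T : E →ₗ[ℂ] H)
    (hT : ∀ x y, Inner.inner ℂ (T x) (T y) = Inner.inner ℂ x y) :
    UniformSpace.Completion E →ₗᵢ[ℂ] H where
  toLinearMap := ((T.isometryOfInner hT).toContinuousLinearMap.extend
    (UniformSpace.Completion.toComplL (𝕜 := ℂ) (E := E))).toLinearMap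
  norm_map' x := by
    induction x using UniformSpace.Completion.induction_on with
    | hp =>
      refine isClosed_eq (Continuous.norm ?_) continuous_norm
      exact ContinuousLinearMap.continuous _
    | ih x =>
      rw [UniformSpace.Completion.norm_coe]
      refine (congrArg norm (ContinuousLinearMap.extend_eq _
        UniformSpace.Completion.denseRange_coe
        (UniformSpace.Completion.isUniformInducing_coe E) x)).trans ?_
      exact (T.isometryOfInner hT).norm_map x

lemma completionIsometry_coe {E H : Type*} [NormedAddCommGroup E] [InnerProductSpace ℂ E]
    [NormedAddCommGroup H] [InnerProductSpace ℂ H] [CompleteSpace H] (T : E →ₗ[ℂ] H)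
    (hT : ∀ x y, Inner.inner ℂ (T x) (T y) = Inner.inner ℂ x y) (x : E) :
    completionIsometry T hT x = T x :=
  ContinuousLinearMap.extend_eq _ UniformSpace.Completion.denseRange_coe
    (UniformSpace.Completion.isUniformInducing_coe E) x

/-- The isometry of the `n`-particle space into the GNS space with `f^{⊗ n} ↦ B⁺ⁿ_f Φ`. -/
def particleIsometry (hφ : φ.IsQuadraticFock)
    (hs : ∀ (n : ℕ) (f g : TestFn d),
      (s n).inner (tensorPow n f) (tensorPow n g) = partitionSum c n f g) (n : ℕ) :
    Particle s n →ₗᵢ[ℂ] φ.GNS :=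
  completionIsometry (E := PreParticle s n) (φ.vecLinear ∘ₗ symWord c n)
    fun x y => (φ.inner_vec _ _).trans (hφ.isVacuum.apply_symWord hs n x y)

lemma particleIsometry_coe (hφ : φ.IsQuadraticFock)
    (hs : ∀ (n : ℕ) (f g : TestFn d),
      (s n).inner (tensorPow n f) (tensorPow n g) = partitionSum c n f g) (n : ℕ)
    (x : symTensor d n) :
    particleIsometry hφ hs n ((show PreParticle s n from x : PreParticle s n) : Particle s n) =
      φ.vec (symWord c n x) :=
  completionIsometry_coe (E := PreParticle s n) _ _ _

/-- Annihilators map the cyclic vector to `0`. -/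
lemma vec_annihilator (hφ : φ.IsQuadraticFock) {x : RSWN d c} (hx : x ∈ annihilatorSpace d c) :
    φ.vec x = 0 := by
  rw [← inner_self_eq_zero (𝕜 := ℂ), φ.inner_vec]
  exact hφ.isVacuum.mul_annihilator _ hx

/-- The GNS vectors `xΦ` lie in the span of the images of the `n`-particle spaces. -/
lemma vec_mem_iSup_range (hφ : φ.IsQuadraticFock)
    (hs : ∀ (n : ℕ) (f g : TestFn d),
      (s n).inner (tensorPow n f) (tensorPow n g) = partitionSum c n f g) (x : RSWN d c) :
    φ.vec x ∈ ⨆ n, LinearMap.range (particleIsometry hφ hs n).toLinearMap := by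
  have h : Submodule.comap φ.vecLinear
      (⨆ n, LinearMap.range (particleIsometry hφ hs n).toLinearMap) = ⊤ := by
    refine eq_top_of_pow_mem (fun n f => ?_) fun y hy => ?_
    · rw [← symWord_tensorPow]
      exact Submodule.mem_iSup_of_mem n ⟨_, particleIsometry_coe hφ hs n _⟩
    · rw [Submodule.mem_comap, φ.vecLinear_apply, vec_annihilator hφ hy]
      exact zero_mem _
  exact (h ▸ Submodule.mem_top : x ∈ Submodule.comap φ.vecLinear _)

lemma isHilbertSum_particleIsometry (hφ : φ.IsQuadraticFock)
    (hs : ∀ (n : ℕ) (f g : TestFn d),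
      (s n).inner (tensorPow n f) (tensorPow n g) = partitionSum c n f g) :
    IsHilbertSum ℂ (fun n => Particle s n) (particleIsometry hφ hs) := by
  refine IsHilbertSum.mk (fun m n hmn x y => ?_) fun x hx => ?_
  · induction x, y using UniformSpace.Completion.induction_on₂ with
    | hp =>
      exact isClosed_eq (((particleIsometry hφ hs m).continuous.comp continuous_fst).inner
        ((particleIsometry hφ hs n).continuous.comp continuous_snd)) continuous_const
    | ih x y =>
      refine (congrArg₂ (Inner.inner ℂ) (particleIsometry_coe hφ hs m x)
        (particleIsometry_coe hφ hs n y)).trans ?_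
      rw [φ.inner_vec]
      exact hφ.isVacuum.star_mul_eq_zero hmn (symWord_mem m x) (symWord_mem n y)
  · clear hx
    induction x using UniformSpace.Completion.induction_on with
    | hp =>
      exact (⨆ n, LinearMap.range
        (particleIsometry hφ hs n).toLinearMap).isClosed_topologicalClosure
    | ih x => exact Submodule.le_topologicalClosure _ (vec_mem_iSup_range hφ hs x)

end GNS

end

theorem lemma2 (d : ℕ) (c : ℝ) (hc : 0 < c) :
    (∃! φ : AlgState (RSWN d c), φ.IsQuadraticFock) ∧
    (∃! s : ScalarProducts d, ∀ (n : ℕ) (f g : TestFn d),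
      (s n).inner (tensorPow n f) (tensorPow n g) = partitionSum c n f g) ∧
    ∀ φ : AlgState (RSWN d c), φ.IsQuadraticFock →
      (∀ (n : ℕ) (f g : TestFn d),
        inner ℂ (φ.particleVec n f) (φ.particleVec n g) = partitionSum c n f g) ∧
      ∀ s : ScalarProducts d,
        (∀ (n : ℕ) (f g : TestFn d),
          (s n).inner (tensorPow n f) (tensorPow n g) = partitionSum c n f g) →
        ∃! U : IFS s ≃ₗᵢ[ℂ] φ.GNS,
          ∀ (n : ℕ) (f : TestFn d), U (IFS.ofTensor s n (tensorPow n f)) = φ.particleVec n f := by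
  refine ⟨existsUnique_isQuadraticFock d hc, existsUnique_scalarProducts d hc,
    fun φ hφ => ⟨fun n f g => ?_, fun s hs => ?_⟩⟩
  · rw [AlgState.particleVec, AlgState.particleVec, φ.inner_vec, star_pow, RSWN.star_Bplus,
      hφ.isVacuum.apply_B_pow_mul_Bplus_pow]
  · refine ⟨(isHilbertSum_particleIsometry hφ hs).linearIsometryEquiv.symm, fun n f => ?_,
      fun V hV => ?_⟩
    · rw [IFS.ofTensor, IsHilbertSum.linearIsometryEquiv_symm_apply_single,
        particleIsometry_coe, RSWN.symWord_tensorPow]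
      rfl
    · set W := (isHilbertSum_particleIsometry hφ hs).linearIsometryEquiv with hW
      have hWf : ∀ n f, W (φ.particleVec n f) = IFS.ofTensor s n (tensorPow n f) := by
        intro n f
        rw [eq_comm, ← LinearIsometryEquiv.symm_apply_eq, IFS.ofTensor, hW,
          IsHilbertSum.linearIsometryEquiv_symm_apply_single, particleIsometry_coe,
          RSWN.symWord_tensorPow]
        rfl
      -- `V` is inverse to `W` on the vectors `xΦ`, hence on the whole GNS space by continuity.
      have h : LinearMap.eqLocus ((V.toLinearEquiv.toLinearMap ∘ₗ W.toLinearEquiv.toLinearMap) ∘ₗ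
          φ.vecLinear) φ.vecLinear = ⊤ := by
        refine RSWN.eq_top_of_pow_mem (fun n f => ?_) fun y hy => ?_
        · change V (W (φ.particleVec n f)) = φ.particleVec n f
          rw [hWf, hV]
        · change V (W (φ.vec y)) = φ.vec y
          rw [vec_annihilator hφ hy, map_zero, map_zero]
      have h' : ∀ ξ : φ.GNS, V (W ξ) = ξ := by
        intro ξ
        induction ξ using UniformSpace.Completion.induction_on with
        | hp => exact isClosed_eq (V.continuous.comp W.continuous) continuous_id
        | ih x => exact (h ▸ Submodule.mem_top : (show RSWN d c from x) ∈ LinearMap.eqLocus _ _)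
      ext1 ξ
      rw [← h' (W.symm ξ), LinearIsometryEquiv.apply_symm_apply]
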